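/- Let $a,b,c>0$ be pairwise distinct, let $$p=\sqrt{\tfrac{a^2-b^2}{a^2-c^2}},\qquad q=\sqrt{\tfrac{b^2-c^2}{a^2-c^2}}$$ (each of $p,q$ is real or purely imaginary, $p^2+q^2=1$; the choice of the square roots does not matter), and let $\mathrm{sn}_q,\mathrm{cn}_q,\mathrm{dn}_q$ be the real Jacobi elliptic functions with modulus $q$ (they depend on $q^2\in\mathbb R$ only). Let $\mathbb R^{2,1}$ be $\mathbb R^3$ with the inner product $-x_1y_1+x_2y_2+x_3y_3$. Consider $$X(u,v)=\frac1{\mathrm{sn}_q u\,\mathrm{dn}_q v}\,\bigl(a\,\mathrm{cn}_q u,\;-b\,\mathrm{sn}_q v\,\mathrm{dn}_q u,\;c\,\mathrm{cn}_q v\bigr)$$ on a connected open set $U\subseteq\mathbb R^2$ of points with $\mathrm{sn}_q u\neq0$, $\mathrm{dn}_q v\neq0$ and $\mathrm{dn}_q(u\pm v)\neq0$ (where $X$ is defined and immersed). Then $X$ parametrizes, by curvature lines (orthogonal conjugate parameters) $(u,v)$, part of the tri-axial $1$-sheeted hyperboloid $-(x_1/a)^2+(x_2/b)^2+(x_3/c)^2=1$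 in $\mathbb R^{2,1}$. A Christoffel dual of $X$ is a surface $Y$ on $U$ with the same curvature line parameters, and $Y_u=\rho X_u$, $Y_v=-\rho X_v$ for a nowhere vanishing real function $\rho$. There is a timelike minimal surface $S:U\to\mathbb R^{2,1}$ (induced metric of Lorentz signature, mean curvature zero) such that $\alpha S$, with $\alpha=\mathrm{diag}(a,b,c)$, is a Christoffel dual of $X$, and any Christoffel dual of $X$ on $U$ is $k\,\alpha S+t$ for some constants $k\in\mathbb R\setminus\{0\}$ and $t\in\mathbb R^3$. Explicitly, if $\mathrm{sn}_q(u\pm v)\neq0$ on $U$, then with the para-complex variable $z=u+jv$, $j^2=1$, one may take $$\alpha S(u,v)=\mathrm{Re}\begin{pmatrix}-\frac{2a}{p}\arctan\frac{\mathrm{cn}_q}{p\,\mathrm{sn}_q}\\[2pt] j\,\frac{2b}{pq}\arctan\frac{q\,\mathrm{cn}_q}{p}\\[2pt] \frac{2c}{q}\,\mathrm{artanh}(q\,\mathrm{sn}_q)\end{pmatrix}(z),$$ where functions of $z$ are the para-complex (Lorentz-analytic) extensions $\tilde f(u+jv)=f(u+v)\frac{1+j}2+f(u-v)\frac{1-j}2$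 of functions $f$ of one variable; for imaginary $p$ or $q$, $\arctan$ and $\mathrm{artanh}$ are given by $\arctan w=\frac1{2i}\ln\frac{1+iw}{1-iw}$, $\mathrm{artanh}\,w=\frac12\ln\frac{1+w}{1-w}$, and $\mathrm{Re}$ also discards imaginary constants. For general $U$ the same formula holds, up to an additive constant vector (a change of the branch of $\arctan$), near every point of $U$ with $\mathrm{sn}_q(u\pm v)\neq0$. -/

import Mathlib

open scoped ContDiff

noncomputable section

/-! ### Real Jacobi elliptic functions

They depend only on the square `m = k ^ 2` of the modulus `k`, which may be any real number `m ≠ 1`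
(so the modulus itself may be real or purely imaginary). -/

/-- The incomplete elliptic integral of the first kind, `m` being the square of the modulus. -/
def ellipticF (m φ : ℝ) : ℝ := ∫ θ in (0 : ℝ)..φ, 1 / √(1 - m * Real.sin θ ^ 2)

/-- The Jacobi amplitude function for `m < 1`: the inverse of `ellipticF m`, which is
an increasing bijection of the real line. -/
def jacobiAm (m t : ℝ) : ℝ := Function.invFun (ellipticF m) t

/-- `sn` with squared modulus `m`. For `m > 1` it is given by the reciprocal modulus
transformation `sn_k t = (1 / k) sn_{1/k} (k t)`. -/
def jacobiSn (m t : ℝ) : ℝ :=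
  if m < 1 then Real.sin (jacobiAm m t) else Real.sin (jacobiAm m⁻¹ (√m * t)) / √m

/-- `cn` with squared modulus `m`. For `m > 1` it is given by the reciprocal modulus
transformation `cn_k t = dn_{1/k} (k t)`. -/
def jacobiCn (m t : ℝ) : ℝ :=
  if m < 1 then Real.cos (jacobiAm m t)
  else √(1 - m⁻¹ * Real.sin (jacobiAm m⁻¹ (√m * t)) ^ 2)

/-- `dn` with squared modulus `m`. For `m > 1` it is given by the reciprocal modulus
transformation `dn_k t = cn_{1/k} (k t)`. -/
def jacobiDn (m t : ℝ) : ℝ :=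
  if m < 1 then √(1 - m * Real.sin (jacobiAm m t) ^ 2)
  else Real.cos (jacobiAm m⁻¹ (√m * t))

/-! ### Para-complex (Lorentz) numbers -/

/-- The algebra `R[j]` with `j ^ 2 = 1`: the Lorentz numbers for `R = ℝ`,
and their complexification for `R = ℂ`. -/
abbrev ParaComplex (R : Type*) [Zero R] [One R] : Type _ := QuadraticAlgebra R 1 0

/-- The unit `j`. -/
def paraJ (R : Type*) [Zero R] [One R] : ParaComplex R := ⟨0, 1⟩

/-- The para-complex extension `f (u + v) (1 + j) / 2 + f (u - v) (1 - j) / 2` at `z = u + j v`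
of a function `f` of one variable: for analytic `f`, its unique Lorentz-analytic extension. -/
def paraExt {R S : Type*} [Field R] [Field S] (f : R → S) (z : ParaComplex R) : ParaComplex S :=
  f (z.re + z.im) • (⟨1 / 2, 1 / 2⟩ : ParaComplex S) +
    f (z.re - z.im) • (⟨1 / 2, -(1 / 2)⟩ : ParaComplex S)

/-- The real part: the component without `j`, of which the complex real part is taken.
(The quantities below are real para-complex, up to additive constants that come from
the multi-valuedness of the complex logarithm and that are imaginary.) -/
def paraRe (w : ParaComplex ℂ) : ℝ := w.re.re

/-- The Lorentz-Jacobi function `sn`, as a function with values in the complexified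
Lorentz numbers (its values do lie in the Lorentz numbers). -/
def paraSn (m : ℝ) (z : ParaComplex ℝ) : ParaComplex ℂ :=
  paraExt (fun t : ℝ => (jacobiSn m t : ℂ)) z

/-- The Lorentz-Jacobi function `cn`. -/
def paraCn (m : ℝ) (z : ParaComplex ℝ) : ParaComplex ℂ :=
  paraExt (fun t : ℝ => (jacobiCn m t : ℂ)) z

/-- The complex inverse hyperbolic tangent, principal branch. -/
def complexArtanh (w : ℂ) : ℂ := 1 / 2 * Complex.log ((1 + w) / (1 - w))

/-- The inverse of a complexified Lorentz number (where it exists). -/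
def paraInv (w : ParaComplex ℂ) : ParaComplex ℂ := paraExt (fun x : ℂ => x⁻¹) w

def paraArctan (w : ParaComplex ℂ) : ParaComplex ℂ := paraExt Complex.arctan w

def paraArtanh (w : ParaComplex ℂ) : ParaComplex ℂ := paraExt complexArtanh w

/-! ### Parametrized surfaces in Minkowski space of signature `(-, +, +)` -/

/-- The Minkowski inner product; the first axis is timelike. -/
def mink (x y : Fin 3 → ℝ) : ℝ := -(x 0 * y 0) + x 1 * y 1 + x 2 * y 2

/-- The partial derivative `∂/∂u`. -/
def partialU (X : ℝ × ℝ → Fin 3 → ℝ) (z : ℝ × ℝ) : Fin 3 → ℝ := fderiv ℝ X z (1, 0)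

/-- The partial derivative `∂/∂v`. -/
def partialV (X : ℝ × ℝ → Fin 3 → ℝ) (z : ℝ × ℝ) : Fin 3 → ℝ := fderiv ℝ X z (0, 1)

/-- `X` is a smooth immersed surface on `U`. -/
def IsImmersedSurface (X : ℝ × ℝ → Fin 3 → ℝ) (U : Set (ℝ × ℝ)) : Prop :=
  ContDiffOn ℝ ∞ X U ∧ ∀ z ∈ U, LinearIndependent ℝ ![partialU X z, partialV X z]

/-- `(u, v)` are curvature line parameters, that is, orthogonal conjugate parameters,
of the immersed surface `X`. -/
structure IsCurvatureLineParametrization (X : ℝ × ℝ → Fin 3 → ℝ) (U : Set (ℝ × ℝ)) : Prop where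
  immersed : IsImmersedSurface X U
  orthogonal : ∀ z ∈ U, mink (partialU X z) (partialV X z) = 0
  conjugate : ∀ z ∈ U, ∃ l k : ℝ,
    partialU (partialV X) z = l • partialU X z + k • partialV X z

/-- `Y` is a Christoffel dual of `X`, both parametrized by common curvature line parameters
`(u, v)`: the surfaces have parallel tangent directions along corresponding curvature lines,
and the correspondence is conformal (with conformal factor `ρ ^ 2`) and reverses orientation. -/
structure IsChristoffelDual (X Y : ℝ × ℝ → Fin 3 → ℝ) (U : Set (ℝ × ℝ)) : Prop where
  left : IsCurvatureLineParametrization X U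
  right : IsCurvatureLineParametrization Y U
  dual : ∃ ρ : ℝ × ℝ → ℝ, ∀ z ∈ U, ρ z ≠ 0 ∧
    partialU Y z = ρ z • partialU X z ∧ partialV Y z = -ρ z • partialV X z

/-- The coefficients `E`, `F`, `G` of the first fundamental form. -/
def formE (X : ℝ × ℝ → Fin 3 → ℝ) (z : ℝ × ℝ) : ℝ := mink (partialU X z) (partialU X z)

def formF (X : ℝ × ℝ → Fin 3 → ℝ) (z : ℝ × ℝ) : ℝ := mink (partialU X z) (partialV X z)

def formG (X : ℝ × ℝ → Fin 3 → ℝ) (z : ℝ × ℝ) : ℝ := mink (partialV X z) (partialV X z)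

/-- The Minkowski cross product: `mink (minkCross x y) w = det (x, y, w)`. -/
def minkCross (x y : Fin 3 → ℝ) : Fin 3 → ℝ :=
  ![-(crossProduct x y 0), crossProduct x y 1, crossProduct x y 2]

/-- The unit normal (where the induced metric does not degenerate). -/
def unitNormal (X : ℝ × ℝ → Fin 3 → ℝ) (z : ℝ × ℝ) : Fin 3 → ℝ :=
  (√|mink (minkCross (partialU X z) (partialV X z)) (minkCross (partialU X z) (partialV X z))|)⁻¹ •
    minkCross (partialU X z) (partialV X z)

/-- The mean curvature, half the trace of the second with respect to the first fundamental form. -/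
def meanCurvature (X : ℝ × ℝ → Fin 3 → ℝ) (z : ℝ × ℝ) : ℝ :=
  (formG X z * mink (partialU (partialU X) z) (unitNormal X z)
    - 2 * formF X z * mink (partialU (partialV X) z) (unitNormal X z)
    + formE X z * mink (partialV (partialV X) z) (unitNormal X z)) /
  (2 * (formE X z * formG X z - formF X z ^ 2))

/-- `X` is a timelike minimal surface on `U`: the induced metric has Lorentz signature, and
the mean curvature vanishes. -/
structure IsTimelikeMinimal (X : ℝ × ℝ → Fin 3 → ℝ) (U : Set (ℝ × ℝ)) : Prop where
  immersed : IsImmersedSurface X U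
  timelike : ∀ z ∈ U, formE X z * formG X z - formF X z ^ 2 < 0
  minimal : ∀ z ∈ U, meanCurvature X z = 0

/-! ### The hyperboloid and its dual -/

/-- The linear map that scales the axes by `a`, `b`, `c`. -/
def axisScaling (a b c : ℝ) (x : Fin 3 → ℝ) : Fin 3 → ℝ := ![a * x 0, b * x 1, c * x 2]

/-- The parametrization of the hyperboloid by Jacobi functions with squared modulus `m`. -/
def hyperboloid (a b c m : ℝ) (z : ℝ × ℝ) : Fin 3 → ℝ :=
  (1 / (jacobiSn m z.1 * jacobiDn m z.2)) •
    ![a * jacobiCn m z.1, -(b * (jacobiSn m z.2 * jacobiDn m z.1)), c * jacobiCn m z.2]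

/-- The regular points: the parametrization of the hyperboloid is defined, and immersed there. -/
def regularSet (m : ℝ) : Set (ℝ × ℝ) :=
  {z | jacobiSn m z.1 ≠ 0 ∧ jacobiDn m z.2 ≠ 0 ∧
    jacobiDn m (z.1 + z.2) ≠ 0 ∧ jacobiDn m (z.1 - z.2) ≠ 0}

/-- The points where the quotient `cn / (p sn)` of Lorentz-Jacobi functions is defined, that is,
where `sn (u + j v)` is invertible. -/
def formulaSet (m : ℝ) : Set (ℝ × ℝ) :=
  {z | jacobiSn m (z.1 + z.2) ≠ 0 ∧ jacobiSn m (z.1 - z.2) ≠ 0}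

/-- The explicit formula for the dual surface, in terms of Lorentz-Jacobi functions
(with squared modulus `m`) of the para-complex variable `z = u + j v`. -/
def dualFormula (a b c m : ℝ) (p q : ℂ) (z : ParaComplex ℝ) : Fin 3 → ℝ :=
  ![paraRe ((-(2 * a / p) : ℂ) • paraArctan (paraCn m z * paraInv (p • paraSn m z))),
    paraRe (paraJ ℂ * ((2 * b / (p * q) : ℂ) • paraArctan ((q / p) • paraCn m z))),
    paraRe ((2 * c / q : ℂ) • paraArtanh (q • paraSn m z))]

end

/-! ### The amplitude function -/

/-! The dual surface is a sum of two null curves. With `nullDirection m ε` equal to (1, ε sn,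
cn)/dn, the identity sn² + cn² = 1 makes this vector null for ε = ±1. Set S(u,v) = P(u+v) + Q(u-v)
with P' and Q' the null directions for ε = -1 and ε = 1. Then S_u and S_v are orthogonal, E = -G and
S_uu = S_vv, so the mean curvature vanishes, and E ≠ 0 on the regular set makes the metric
Lorentzian (`IsPrimitiveTriple.isTimelikeMinimal`).

The link with the hyperboloid X is the addition theorems (`jacobiSn_add`, `jacobiCn_add`,
`jacobiDn_add`). They write the null directions at u+v and u-v over one common denominator D =
`jacobiDnProd m u v`, even in v, so that P' + Q' and P' - Q' become monomials in functions of u and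
of v, divided by D (`nullDirection_add_sub`). Scaling the axes by a, b, c and comparing with the
derivatives of X gives αS_u = ρX_u and αS_v = -ρX_v with ρ = -2 sn²u dn²v / D. That X has curvature
line parameters is a direct computation, orthogonality being equivalent in essence to m(a² - c²) =
b² - c².

For uniqueness, two duals T, Y satisfy dY = k dT for a function k. Symmetry of second derivatives
gives k_u T_v = k_v T_u, so dk = 0 and k is constant on the connected set U
(`exists_eq_smul_add_of_partial`).

The explicit formula follows because the idempotents (1 ± j)/2 split para-complex functions into
values at u+v and u-v (`dualFormula_eq`), and the functions in it are primitives of 2/dn, -2 sn/dn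
and 2 cn/dn. Since only real parts matter, one derivative lemma, `hasDerivAt_re_mul_arctan`, covers
real and imaginary p and q without branch problems. -/

theorem one_sub_mul_sin_sq_pos {m : ℝ} (hm : m < 1) (θ : ℝ) : 0 < 1 - m * Real.sin θ ^ 2 := by
  have h0 := sq_nonneg (Real.sin θ)
  have h1 := Real.sin_sq_le_one θ
  rcases le_or_gt m 0 with h | h <;> nlinarith

theorem continuous_ellipticF_integrand {m : ℝ} (hm : m < 1) :
    Continuous fun θ : ℝ => 1 / √(1 - m * Real.sin θ ^ 2) :=
  continuous_const.div (by fun_prop) fun θ => (Real.sqrt_pos.2 (one_sub_mul_sin_sq_pos hm θ)).ne'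

theorem hasDerivAt_ellipticF {m : ℝ} (hm : m < 1) (φ : ℝ) :
    HasDerivAt (ellipticF m) (1 / √(1 - m * Real.sin φ ^ 2)) φ :=
  ((continuous_ellipticF_integrand hm).integral_hasStrictDerivAt 0 φ).hasDerivAt

theorem strictMono_ellipticF {m : ℝ} (hm : m < 1) : StrictMono (ellipticF m) :=
  strictMono_of_deriv_pos fun φ => by
    rw [(hasDerivAt_ellipticF hm φ).deriv]
    have := Real.sqrt_pos.2 (one_sub_mul_sin_sq_pos hm φ)
    positivity

theorem ellipticF_zero (m : ℝ) : ellipticF m 0 = 0 := by simp [ellipticF]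

theorem ellipticF_neg (m φ : ℝ) : ellipticF m (-φ) = -ellipticF m φ := by
  have h := intervalIntegral.integral_comp_neg (a := 0) (b := φ)
    (fun θ : ℝ => 1 / √(1 - m * Real.sin θ ^ 2))
  simp only [Real.sin_neg, neg_sq, neg_zero] at h
  rw [ellipticF, ellipticF, intervalIntegral.integral_symm, h]

/-- The integrand is at least 1/√(1 + |m|), so the integral grows at least linearly in both
directions. -/
theorem surjective_ellipticF {m : ℝ} (hm : m < 1) : Function.Surjective (ellipticF m) := by
  set κ : ℝ := 1 / √(1 + |m|) with hκ
  have hκ0 : 0 < κ := by positivity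
  have hmono : Monotone fun φ => ellipticF m φ - κ * φ := by
    have hd : ∀ φ, HasDerivAt (fun φ => ellipticF m φ - κ * φ)
        (1 / √(1 - m * Real.sin φ ^ 2) - κ * 1) φ := fun φ =>
      (hasDerivAt_ellipticF hm φ).sub ((hasDerivAt_id φ).const_mul κ)
    refine monotone_of_deriv_nonneg (fun φ => (hd φ).differentiableAt) fun φ => ?_
    rw [(hd φ).deriv, mul_one, sub_nonneg, hκ]
    refine one_div_le_one_div_of_le (Real.sqrt_pos.2 (one_sub_mul_sin_sq_pos hm φ))
      (Real.sqrt_le_sqrt ?_)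
    have h0 := sq_nonneg (Real.sin φ)
    have h1 := Real.sin_sq_le_one φ
    have h2 := neg_abs_le m
    have h3 := abs_nonneg m
    nlinarith
  have h0 : ellipticF m 0 - κ * 0 = 0 := by simp [ellipticF_zero]
  refine Continuous.surjective
    (continuous_iff_continuousAt.2 fun φ => (hasDerivAt_ellipticF hm φ).continuousAt) ?_ ?_
  · refine Filter.tendsto_atTop_mono' _ ?_ (Filter.tendsto_id.const_mul_atTop hκ0)
    filter_upwards [Filter.eventually_ge_atTop 0] with φ hφ
    have := hmono hφ
    simp only [id] at *
    linarith
  · refine Filter.tendsto_atBot_mono' _ ?_ (Filter.tendsto_id.const_mul_atBot hκ0)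
    filter_upwards [Filter.eventually_le_atBot 0] with φ hφ
    have := hmono hφ
    simp only [id] at *
    linarith

theorem ellipticF_jacobiAm {m : ℝ} (hm : m < 1) (t : ℝ) : ellipticF m (jacobiAm m t) = t :=
  Function.rightInverse_invFun (surjective_ellipticF hm) t

theorem jacobiAm_ellipticF {m : ℝ} (hm : m < 1) (φ : ℝ) : jacobiAm m (ellipticF m φ) = φ :=
  Function.leftInverse_invFun (strictMono_ellipticF hm).injective φ

theorem jacobiAm_zero {m : ℝ} (hm : m < 1) : jacobiAm m 0 = 0 := by
  simpa only [ellipticF_zero] using jacobiAm_ellipticF hm 0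

theorem jacobiAm_neg {m : ℝ} (hm : m < 1) (t : ℝ) : jacobiAm m (-t) = -jacobiAm m t := by
  apply (strictMono_ellipticF hm).injective
  rw [ellipticF_neg, ellipticF_jacobiAm hm, ellipticF_jacobiAm hm]

theorem continuous_jacobiAm {m : ℝ} (hm : m < 1) : Continuous (jacobiAm m) := by
  refine Monotone.continuous_of_surjective (fun x y hxy => ?_)
    fun φ => ⟨ellipticF m φ, jacobiAm_ellipticF hm φ⟩
  rw [← (strictMono_ellipticF hm).le_iff_le, ellipticF_jacobiAm hm, ellipticF_jacobiAm hm]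
  exact hxy

theorem hasDerivAt_jacobiAm {m : ℝ} (hm : m < 1) (t : ℝ) :
    HasDerivAt (jacobiAm m) √(1 - m * Real.sin (jacobiAm m t) ^ 2) t := by
  have hpos := Real.sqrt_pos.2 (one_sub_mul_sin_sq_pos hm (jacobiAm m t))
  have h := HasDerivAt.of_local_left_inverse (continuous_jacobiAm hm).continuousAt
    (hasDerivAt_ellipticF hm (jacobiAm m t)) (by positivity)
    (Filter.Eventually.of_forall fun y => ellipticF_jacobiAm hm y)
  simpa using h

theorem hasDerivAt_sin_jacobiAm {m : ℝ} (hm : m < 1) (t : ℝ) :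
    HasDerivAt (fun t => Real.sin (jacobiAm m t))
      (Real.cos (jacobiAm m t) * √(1 - m * Real.sin (jacobiAm m t) ^ 2)) t :=
  (hasDerivAt_jacobiAm hm t).sin

theorem hasDerivAt_cos_jacobiAm {m : ℝ} (hm : m < 1) (t : ℝ) :
    HasDerivAt (fun t => Real.cos (jacobiAm m t))
      (-Real.sin (jacobiAm m t) * √(1 - m * Real.sin (jacobiAm m t) ^ 2)) t :=
  (hasDerivAt_jacobiAm hm t).cos

theorem hasDerivAt_sqrt_jacobiAm {m : ℝ} (hm : m < 1) (t : ℝ) :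
    HasDerivAt (fun t => √(1 - m * Real.sin (jacobiAm m t) ^ 2))
      (-(m * Real.sin (jacobiAm m t) * Real.cos (jacobiAm m t))) t := by
  have hpos := one_sub_mul_sin_sq_pos hm (jacobiAm m t)
  have hs := Real.sqrt_pos.2 hpos
  have h := ((((hasDerivAt_sin_jacobiAm hm t).pow 2).const_mul m).const_sub 1).sqrt hpos.ne'
  refine h.congr_deriv ?_
  rw [Pi.pow_apply]
  push_cast
  field_simp

/-! ### Derivatives and quadratic relations of the Jacobi functions -/

theorem inv_lt_one_of_not_lt {m : ℝ} (hm : m ≠ 1) (h : ¬m < 1) : m⁻¹ < 1 :=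
  inv_lt_one_of_one_lt₀ (lt_of_le_of_ne (not_lt.1 h) hm.symm)

theorem jacobiSn_zero {m : ℝ} (hm : m ≠ 1) : jacobiSn m 0 = 0 := by
  unfold jacobiSn
  split_ifs with h
  · simp [jacobiAm_zero h]
  · simp [jacobiAm_zero (inv_lt_one_of_not_lt hm h)]

theorem jacobiCn_zero {m : ℝ} (hm : m ≠ 1) : jacobiCn m 0 = 1 := by
  unfold jacobiCn
  split_ifs with h
  · simp [jacobiAm_zero h]
  · simp [jacobiAm_zero (inv_lt_one_of_not_lt hm h)]

theorem jacobiDn_zero {m : ℝ} (hm : m ≠ 1) : jacobiDn m 0 = 1 := by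
  unfold jacobiDn
  split_ifs with h
  · simp [jacobiAm_zero h]
  · simp [jacobiAm_zero (inv_lt_one_of_not_lt hm h)]

theorem jacobiSn_neg {m : ℝ} (hm : m ≠ 1) (t : ℝ) : jacobiSn m (-t) = -jacobiSn m t := by
  unfold jacobiSn
  split_ifs with h
  · simp [jacobiAm_neg h]
  · simp [jacobiAm_neg (inv_lt_one_of_not_lt hm h), neg_div]

theorem jacobiCn_neg {m : ℝ} (hm : m ≠ 1) (t : ℝ) : jacobiCn m (-t) = jacobiCn m t := by
  unfold jacobiCn
  split_ifs with h
  · simp [jacobiAm_neg h]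
  · simp [jacobiAm_neg (inv_lt_one_of_not_lt hm h)]

theorem jacobiDn_neg {m : ℝ} (hm : m ≠ 1) (t : ℝ) : jacobiDn m (-t) = jacobiDn m t := by
  unfold jacobiDn
  split_ifs with h
  · simp [jacobiAm_neg h]
  · simp [jacobiAm_neg (inv_lt_one_of_not_lt hm h)]

theorem jacobiCn_sq {m : ℝ} (hm : m ≠ 1) (t : ℝ) : jacobiCn m t ^ 2 = 1 - jacobiSn m t ^ 2 := by
  unfold jacobiCn jacobiSn
  split_ifs with h
  · rw [Real.cos_sq']
  · have hm0 : 0 < m := by linarith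
    rw [Real.sq_sqrt (one_sub_mul_sin_sq_pos (inv_lt_one_of_not_lt hm h) _).le, div_pow,
      Real.sq_sqrt hm0.le]
    field_simp

theorem jacobiDn_sq (m t : ℝ) :
    jacobiDn m t ^ 2 = 1 - m * jacobiSn m t ^ 2 := by
  unfold jacobiDn jacobiSn
  split_ifs with h
  · rw [Real.sq_sqrt (one_sub_mul_sin_sq_pos h _).le]
  · have hm0 : 0 < m := by linarith
    rw [Real.cos_sq', div_pow, Real.sq_sqrt hm0.le]
    field_simp

theorem hasDerivAt_jacobiSn {m : ℝ} (hm : m ≠ 1) (t : ℝ) :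
    HasDerivAt (jacobiSn m) (jacobiCn m t * jacobiDn m t) t := by
  by_cases h : m < 1
  · have e : jacobiSn m = fun t => Real.sin (jacobiAm m t) := funext fun t => if_pos h
    rw [e]
    simp only [jacobiCn, jacobiDn, if_pos h]
    exact (hasDerivAt_sin_jacobiAm h t).congr_deriv (by ring)
  · have hr : 0 < √m := Real.sqrt_pos.2 (by linarith)
    have h1 := inv_lt_one_of_not_lt hm h
    have h2 := ((hasDerivAt_sin_jacobiAm h1 (√m * t)).comp t
      ((hasDerivAt_id t).const_mul √m)).div_const √m
    have e : jacobiSn m = fun t => Real.sin (jacobiAm m⁻¹ (√m * t)) / √m :=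
      funext fun t => if_neg h
    rw [e]
    simp only [jacobiCn, jacobiDn, if_neg h]
    refine h2.congr_deriv ?_
    field_simp

theorem hasDerivAt_jacobiCn {m : ℝ} (hm : m ≠ 1) (t : ℝ) :
    HasDerivAt (jacobiCn m) (-(jacobiSn m t * jacobiDn m t)) t := by
  by_cases h : m < 1
  · have e : jacobiCn m = fun t => Real.cos (jacobiAm m t) := funext fun t => if_pos h
    rw [e]
    simp only [jacobiSn, jacobiDn, if_pos h]
    exact (hasDerivAt_cos_jacobiAm h t).congr_deriv (by ring)
  · have hr : 0 < √m := Real.sqrt_pos.2 (by linarith)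
    have h1 := inv_lt_one_of_not_lt hm h
    have h2 := (hasDerivAt_sqrt_jacobiAm h1 (√m * t)).comp t ((hasDerivAt_id t).const_mul √m)
    have e : jacobiCn m = fun t => √(1 - m⁻¹ * Real.sin (jacobiAm m⁻¹ (√m * t)) ^ 2) :=
      funext fun t => if_neg h
    rw [e]
    simp only [jacobiSn, jacobiDn, if_neg h]
    refine h2.congr_deriv ?_
    have h3 : m⁻¹ * √m = (√m)⁻¹ := by
      rw [inv_mul_eq_div, ← one_div, Real.sqrt_div_self']
    linear_combination (-(Real.sin (jacobiAm m⁻¹ (√m * t)) *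
      Real.cos (jacobiAm m⁻¹ (√m * t)))) * h3

theorem hasDerivAt_jacobiDn {m : ℝ} (hm : m ≠ 1) (t : ℝ) :
    HasDerivAt (jacobiDn m) (-(m * jacobiSn m t * jacobiCn m t)) t := by
  by_cases h : m < 1
  · have e : jacobiDn m = fun t => √(1 - m * Real.sin (jacobiAm m t) ^ 2) := funext fun t => if_pos h
    rw [e]
    simp only [jacobiSn, jacobiCn, if_pos h]
    exact (hasDerivAt_sqrt_jacobiAm h t).congr_deriv (by ring)
  · have hr : 0 < √m := Real.sqrt_pos.2 (by linarith)
    have h1 := inv_lt_one_of_not_lt hm h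
    have h2 := (hasDerivAt_cos_jacobiAm h1 (√m * t)).comp t ((hasDerivAt_id t).const_mul √m)
    have e : jacobiDn m = fun t => Real.cos (jacobiAm m⁻¹ (√m * t)) :=
      funext fun t => if_neg h
    rw [e]
    simp only [jacobiSn, jacobiCn, if_neg h]
    refine h2.congr_deriv ?_
    rw [mul_one, div_eq_mul_inv]
    have h3 : m * (√m)⁻¹ = √m := by
      rw [← div_eq_mul_inv, Real.div_sqrt]
    linear_combination (Real.sin (jacobiAm m⁻¹ (√m * t)) *
      √(1 - m⁻¹ * Real.sin (jacobiAm m⁻¹ (√m * t)) ^ 2)) * h3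

/-- The denominator of the addition theorems has no real zeros. It equals cn²v + dn²u sn²v, so a
zero would force cn v = 0 and dn u = 0, hence sn²v = 1 and m sn²u = 1. Then dn²v = 1 - m ≥ 0 gives m
< 1, which contradicts sn²u ≤ 1. -/
theorem one_sub_mul_jacobiSn_sq_pos {m : ℝ} (hm : m ≠ 1) (u v : ℝ) :
    0 < 1 - m * jacobiSn m u ^ 2 * jacobiSn m v ^ 2 := by
  have hu := jacobiCn_sq hm u
  have hv := jacobiCn_sq hm v
  have hu' := jacobiDn_sq m u
  have h1 := sq_nonneg (jacobiCn m u)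
  have h2 := sq_nonneg (jacobiCn m v)
  have h3 := sq_nonneg (jacobiDn m u)
  have h4 := sq_nonneg (jacobiSn m v)
  have h5 := sq_nonneg (jacobiSn m u)
  have key : 1 - m * jacobiSn m u ^ 2 * jacobiSn m v ^ 2 =
      jacobiCn m v ^ 2 + jacobiDn m u ^ 2 * jacobiSn m v ^ 2 := by
    rw [hv, hu']; ring
  rw [key]
  refine lt_of_le_of_ne (by positivity) fun h0 => ?_
  have h6 : jacobiCn m v ^ 2 = 0 := by nlinarith [mul_nonneg h3 h4]
  have h7 : jacobiDn m u ^ 2 = 0 := by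
    have : jacobiSn m v ^ 2 = 1 := by linarith
    rw [h6, this] at h0; linarith
  have h8 : 1 - m * jacobiSn m v ^ 2 * jacobiSn m u ^ 2 = 0 := by
    have : jacobiSn m v ^ 2 = 1 := by linarith
    rw [this]; linarith
  have h9 := jacobiDn_sq m v
  have h10 := sq_nonneg (jacobiDn m v)
  have h11 : jacobiSn m v ^ 2 = 1 := by linarith
  have hm1 : m ≤ 1 := by nlinarith
  have hm2 : m < 1 := lt_of_le_of_ne hm1 hm
  rcases le_or_gt m 0 with h | h <;> nlinarith

theorem jacobiDn_pos {m : ℝ} (hm : m < 1) (t : ℝ) : 0 < jacobiDn m t := by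
  rw [jacobiDn, if_pos hm]
  exact Real.sqrt_pos.2 (one_sub_mul_sin_sq_pos hm _)

theorem jacobiCn_pos {m : ℝ} (hm : 1 < m) (t : ℝ) : 0 < jacobiCn m t := by
  rw [jacobiCn, if_neg hm.not_gt]
  exact Real.sqrt_pos.2 (one_sub_mul_sin_sq_pos (inv_lt_one_of_one_lt₀ hm) _)

/-- The derivatives of sn, cn, dn are polynomials in the same three functions, so regularity
bootstraps when all three are treated together. -/
theorem contDiff_jacobi {m : ℝ} (hm : m ≠ 1) :
    ContDiff ℝ ∞ (jacobiSn m) ∧ ContDiff ℝ ∞ (jacobiCn m) ∧ ContDiff ℝ ∞ (jacobiDn m) := by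
  have key : ∀ n : ℕ, ContDiff ℝ n (jacobiSn m) ∧ ContDiff ℝ n (jacobiCn m) ∧
      ContDiff ℝ n (jacobiDn m) := by
    intro n
    induction n with
    | zero =>
      refine ⟨?_, ?_, ?_⟩ <;> refine contDiff_zero.2 (continuous_iff_continuousAt.2 fun t => ?_)
      · exact (hasDerivAt_jacobiSn hm t).continuousAt
      · exact (hasDerivAt_jacobiCn hm t).continuousAt
      · exact (hasDerivAt_jacobiDn hm t).continuousAt
    | succ n ih =>
      obtain ⟨hs, hc, hd⟩ := ih
      push_cast
      refine ⟨?_, ?_, ?_⟩ <;> refine contDiff_succ_iff_deriv.2 ⟨fun t => ?_, by simp, ?_⟩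
      · exact (hasDerivAt_jacobiSn hm t).differentiableAt
      · rw [funext fun t => (hasDerivAt_jacobiSn hm t).deriv]
        exact hc.mul hd
      · exact (hasDerivAt_jacobiCn hm t).differentiableAt
      · rw [funext fun t => (hasDerivAt_jacobiCn hm t).deriv]
        exact (hs.mul hd).neg
      · exact (hasDerivAt_jacobiDn hm t).differentiableAt
      · rw [funext fun t => (hasDerivAt_jacobiDn hm t).deriv]
        exact ((contDiff_const.mul hs).mul hc).neg
  exact ⟨contDiff_infty.2 fun n => (key n).1, contDiff_infty.2 fun n => (key n).2.1,
    contDiff_infty.2 fun n => (key n).2.2⟩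

/-! ### Addition theorems -/

theorem eq_of_hasDerivAt_div_zero {N Δ N' Δ' : ℝ → ℝ} (hN : ∀ t, HasDerivAt N (N' t) t)
    (hΔ : ∀ t, HasDerivAt Δ (Δ' t) t) (h0 : ∀ t, Δ t ≠ 0)
    (h : ∀ t, N' t * Δ t - N t * Δ' t = 0) (x y : ℝ) : N x / Δ x = N y / Δ y := by
  have hd : ∀ t, HasDerivAt (fun t => N t / Δ t) 0 t := fun t => by
    have := (hN t).div (hΔ t) (h0 t)
    rw [h t, zero_div] at this
    exact this
  exact is_const_of_deriv_eq_zero (fun t => (hd t).differentiableAt) (fun t => (hd t).deriv) x y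

theorem hasDerivAt_addition_denom {m : ℝ} (hm : m ≠ 1) (w t : ℝ) :
    HasDerivAt (fun t => 1 - m * jacobiSn m t ^ 2 * jacobiSn m (w - t) ^ 2)
      (-(2 * m * jacobiSn m t * jacobiSn m (w - t) *
        (jacobiCn m t * jacobiDn m t * jacobiSn m (w - t) -
          jacobiSn m t * (jacobiCn m (w - t) * jacobiDn m (w - t))))) t := by
  have h := ((((hasDerivAt_jacobiSn hm t).pow 2).const_mul m).mul
    (((hasDerivAt_jacobiSn hm (w - t)).comp_const_sub w t).pow 2)).const_sub 1
  refine h.congr_deriv ?_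
  simp only [Pi.pow_apply]
  push_cast
  ring

/-- Fix w = u + v and replace (u, v) by (t, w - t). The quotient of the right side by the
denominator has zero derivative in t, by the quadratic relations, so its value at t = u is its value
sn w at t = 0. The same argument proves the theorems for cn and dn. -/
theorem jacobiSn_add {m : ℝ} (hm : m ≠ 1) (u v : ℝ) :
    jacobiSn m (u + v) * (1 - m * jacobiSn m u ^ 2 * jacobiSn m v ^ 2) =
      jacobiSn m u * jacobiCn m v * jacobiDn m v + jacobiSn m v * jacobiCn m u * jacobiDn m u := by
  have hN : ∀ w t, HasDerivAt (fun t => jacobiSn m t * jacobiCn m (w - t) * jacobiDn m (w - t) +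
      jacobiSn m (w - t) * jacobiCn m t * jacobiDn m t) _ t := fun w t =>
    (((hasDerivAt_jacobiSn hm t).mul ((hasDerivAt_jacobiCn hm (w - t)).comp_const_sub w t)).mul
      ((hasDerivAt_jacobiDn hm (w - t)).comp_const_sub w t)).add
    ((((hasDerivAt_jacobiSn hm (w - t)).comp_const_sub w t).mul (hasDerivAt_jacobiCn hm t)).mul
      (hasDerivAt_jacobiDn hm t))
  have := eq_of_hasDerivAt_div_zero (hN (u + v)) (hasDerivAt_addition_denom hm (u + v))
    (fun t => (one_sub_mul_jacobiSn_sq_pos hm t (u + v - t)).ne') (fun t => by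
      have c1 := jacobiCn_sq hm t
      have c2 := jacobiCn_sq hm (u + v - t)
      have d1 := jacobiDn_sq m t
      have d2 := jacobiDn_sq m (u + v - t)
      simp only [Pi.mul_apply]
      generalize jacobiSn m t = S₁, jacobiCn m t = C₁, jacobiDn m t = D₁,
        jacobiSn m (u + v - t) = S₂, jacobiCn m (u + v - t) = C₂, jacobiDn m (u + v - t) = D₂ at *
      grind) u 0
  have e := (one_sub_mul_jacobiSn_sq_pos hm u v).ne'
  simp only [add_sub_cancel_left, sub_zero, jacobiSn_zero hm, jacobiCn_zero hm,
    jacobiDn_zero hm] at this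
  rw [div_eq_iff e] at this
  rw [this]
  simp

theorem jacobiCn_add {m : ℝ} (hm : m ≠ 1) (u v : ℝ) :
    jacobiCn m (u + v) * (1 - m * jacobiSn m u ^ 2 * jacobiSn m v ^ 2) =
      jacobiCn m u * jacobiCn m v - jacobiSn m u * jacobiSn m v * jacobiDn m u * jacobiDn m v := by
  have hN : ∀ w t, HasDerivAt (fun t => jacobiCn m t * jacobiCn m (w - t) -
      jacobiSn m t * jacobiSn m (w - t) * jacobiDn m t * jacobiDn m (w - t)) _ t := fun w t =>
    ((hasDerivAt_jacobiCn hm t).mul ((hasDerivAt_jacobiCn hm (w - t)).comp_const_sub w t)).sub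
    ((((hasDerivAt_jacobiSn hm t).mul ((hasDerivAt_jacobiSn hm (w - t)).comp_const_sub w t)).mul
      (hasDerivAt_jacobiDn hm t)).mul ((hasDerivAt_jacobiDn hm (w - t)).comp_const_sub w t))
  have := eq_of_hasDerivAt_div_zero (hN (u + v)) (hasDerivAt_addition_denom hm (u + v))
    (fun t => (one_sub_mul_jacobiSn_sq_pos hm t (u + v - t)).ne') (fun t => by
      have c1 := jacobiCn_sq hm t
      have c2 := jacobiCn_sq hm (u + v - t)
      have d1 := jacobiDn_sq m t
      have d2 := jacobiDn_sq m (u + v - t)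
      simp only [Pi.mul_apply]
      generalize jacobiSn m t = S₁, jacobiCn m t = C₁, jacobiDn m t = D₁,
        jacobiSn m (u + v - t) = S₂, jacobiCn m (u + v - t) = C₂, jacobiDn m (u + v - t) = D₂ at *
      grind) u 0
  have e := (one_sub_mul_jacobiSn_sq_pos hm u v).ne'
  simp only [add_sub_cancel_left, sub_zero, jacobiSn_zero hm, jacobiCn_zero hm,
    jacobiDn_zero hm] at this
  rw [div_eq_iff e] at this
  rw [this]
  simp

theorem jacobiDn_add {m : ℝ} (hm : m ≠ 1) (u v : ℝ) :
    jacobiDn m (u + v) * (1 - m * jacobiSn m u ^ 2 * jacobiSn m v ^ 2) =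
      jacobiDn m u * jacobiDn m v -
        m * jacobiSn m u * jacobiSn m v * jacobiCn m u * jacobiCn m v := by
  have hN : ∀ w t, HasDerivAt (fun t => jacobiDn m t * jacobiDn m (w - t) -
      m * jacobiSn m t * jacobiSn m (w - t) * jacobiCn m t * jacobiCn m (w - t)) _ t := fun w t =>
    ((hasDerivAt_jacobiDn hm t).mul ((hasDerivAt_jacobiDn hm (w - t)).comp_const_sub w t)).sub
    (((((hasDerivAt_jacobiSn hm t).const_mul m).mul
      ((hasDerivAt_jacobiSn hm (w - t)).comp_const_sub w t)).mul
      (hasDerivAt_jacobiCn hm t)).mul ((hasDerivAt_jacobiCn hm (w - t)).comp_const_sub w t))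
  have := eq_of_hasDerivAt_div_zero (hN (u + v)) (hasDerivAt_addition_denom hm (u + v))
    (fun t => (one_sub_mul_jacobiSn_sq_pos hm t (u + v - t)).ne') (fun t => by
      have c1 := jacobiCn_sq hm t
      have c2 := jacobiCn_sq hm (u + v - t)
      have d1 := jacobiDn_sq m t
      have d2 := jacobiDn_sq m (u + v - t)
      simp only [Pi.mul_apply]
      generalize jacobiSn m t = S₁, jacobiCn m t = C₁, jacobiDn m t = D₁,
        jacobiSn m (u + v - t) = S₂, jacobiCn m (u + v - t) = C₂, jacobiDn m (u + v - t) = D₂ at *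
      grind) u 0
  have e := (one_sub_mul_jacobiSn_sq_pos hm u v).ne'
  simp only [add_sub_cancel_left, sub_zero, jacobiSn_zero hm, jacobiCn_zero hm,
    jacobiDn_zero hm] at this
  rw [div_eq_iff e] at this
  rw [this]
  simp

/-! ### Common-denominator formulas for 1/dn, sn/dn and cn/dn at a sum -/

/-- The numerator of `dn (u + v) dn (u - v)`. -/
noncomputable def jacobiDnProd (m u v : ℝ) : ℝ :=
  jacobiDn m u ^ 2 - m * jacobiSn m v ^ 2 * jacobiCn m u ^ 2

theorem jacobiDnProd_neg {m : ℝ} (hm : m ≠ 1) (u v : ℝ) :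
    jacobiDnProd m u (-v) = jacobiDnProd m u v := by
  simp [jacobiDnProd, jacobiSn_neg hm]

theorem jacobiDn_add_mul {m : ℝ} (hm : m ≠ 1) (u v : ℝ) :
    jacobiDn m (u + v) * (jacobiDn m u * jacobiDn m v +
      m * jacobiSn m u * jacobiSn m v * jacobiCn m u * jacobiCn m v) = jacobiDnProd m u v := by
  refine mul_right_cancel₀ (one_sub_mul_jacobiSn_sq_pos hm u v).ne' ?_
  rw [mul_right_comm, jacobiDn_add hm, jacobiDnProd]
  have c1 := jacobiCn_sq hm u
  have c2 := jacobiCn_sq hm v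
  have d1 := jacobiDn_sq m u
  have d2 := jacobiDn_sq m v
  grind

theorem jacobiSn_add_mul {m : ℝ} (hm : m ≠ 1) (u v : ℝ) :
    jacobiSn m (u + v) * jacobiDnProd m u v = jacobiDn m (u + v) *
      (jacobiSn m u * jacobiDn m u * jacobiCn m v + jacobiSn m v * jacobiDn m v * jacobiCn m u) := by
  refine mul_right_cancel₀ (one_sub_mul_jacobiSn_sq_pos hm u v).ne' ?_
  rw [mul_right_comm, jacobiSn_add hm, mul_right_comm (jacobiDn m (u + v)),
    jacobiDn_add hm, jacobiDnProd]
  have c1 := jacobiCn_sq hm u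
  have c2 := jacobiCn_sq hm v
  have d1 := jacobiDn_sq m u
  have d2 := jacobiDn_sq m v
  grind

theorem jacobiCn_add_mul {m : ℝ} (hm : m ≠ 1) (u v : ℝ) :
    jacobiCn m (u + v) * jacobiDnProd m u v = jacobiDn m (u + v) *
      (jacobiCn m u * jacobiDn m u * (jacobiCn m v * jacobiDn m v) -
        (1 - m) * jacobiSn m u * jacobiSn m v) := by
  refine mul_right_cancel₀ (one_sub_mul_jacobiSn_sq_pos hm u v).ne' ?_
  rw [mul_right_comm, jacobiCn_add hm, mul_right_comm (jacobiDn m (u + v)),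
    jacobiDn_add hm, jacobiDnProd]
  have c1 := jacobiCn_sq hm u
  have c2 := jacobiCn_sq hm v
  have d1 := jacobiDn_sq m u
  have d2 := jacobiDn_sq m v
  grind

/-- Multiplying the addition theorem for dn at v and at -v shows D = dn(u+v) dn(u-v) (1 - m sn²u
sn²v). This is how the condition dn(u ± v) ≠ 0 in `regularSet` enters. -/
theorem jacobiDnProd_ne_zero {m : ℝ} (hm : m ≠ 1) {u v : ℝ} (h₁ : jacobiDn m (u + v) ≠ 0)
    (h₂ : jacobiDn m (u - v) ≠ 0) : jacobiDnProd m u v ≠ 0 := by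
  have key : jacobiDn m (u + v) * (jacobiDn m (u - v) *
      (1 - m * jacobiSn m u ^ 2 * jacobiSn m v ^ 2)) = jacobiDnProd m u v := by
    have h := jacobiDn_add hm u (-v)
    simp only [jacobiSn_neg hm, jacobiCn_neg hm, jacobiDn_neg hm, neg_sq] at h
    rw [sub_eq_add_neg, h, ← jacobiDn_add_mul hm]
    ring
  rw [← key]
  exact mul_ne_zero h₁ (mul_ne_zero h₂ (one_sub_mul_jacobiSn_sq_pos hm u v).ne')

theorem one_div_jacobiDn_add {m : ℝ} (hm : m ≠ 1) {u v : ℝ} (h : jacobiDn m (u + v) ≠ 0)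
    (h₀ : jacobiDnProd m u v ≠ 0) :
    1 / jacobiDn m (u + v) = (jacobiDn m u * jacobiDn m v +
      m * jacobiSn m u * jacobiSn m v * jacobiCn m u * jacobiCn m v) / jacobiDnProd m u v := by
  rw [div_eq_div_iff h h₀, one_mul, ← jacobiDn_add_mul hm, mul_comm]

theorem jacobiSn_div_jacobiDn_add {m : ℝ} (hm : m ≠ 1) {u v : ℝ} (h : jacobiDn m (u + v) ≠ 0)
    (h₀ : jacobiDnProd m u v ≠ 0) :
    jacobiSn m (u + v) / jacobiDn m (u + v) = (jacobiSn m u * jacobiDn m u * jacobiCn m v +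
      jacobiSn m v * jacobiDn m v * jacobiCn m u) / jacobiDnProd m u v := by
  rw [div_eq_div_iff h h₀, jacobiSn_add_mul hm, mul_comm]

theorem jacobiCn_div_jacobiDn_add {m : ℝ} (hm : m ≠ 1) {u v : ℝ} (h : jacobiDn m (u + v) ≠ 0)
    (h₀ : jacobiDnProd m u v ≠ 0) :
    jacobiCn m (u + v) / jacobiDn m (u + v) =
      (jacobiCn m u * jacobiDn m u * (jacobiCn m v * jacobiDn m v) -
        (1 - m) * jacobiSn m u * jacobiSn m v) / jacobiDnProd m u v := by
  rw [div_eq_div_iff h h₀, jacobiCn_add_mul hm, mul_comm]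

/-! ### Partial derivatives of parametrized surfaces -/

theorem partialU_eq_of_hasDerivAt {X : ℝ × ℝ → Fin 3 → ℝ} {z : ℝ × ℝ} {X' : Fin 3 → ℝ}
    (hX : DifferentiableAt ℝ X z) (h : HasDerivAt (fun t => X (t, z.2)) X' z.1) :
    partialU X z = X' :=
  (HasFDerivAt.comp_hasDerivAt (x := z.1) (f := fun t : ℝ => (t, z.2)) hX.hasFDerivAt
    ((hasDerivAt_id z.1).prodMk (hasDerivAt_const z.1 z.2))).unique h

theorem partialV_eq_of_hasDerivAt {X : ℝ × ℝ → Fin 3 → ℝ} {z : ℝ × ℝ} {X' : Fin 3 → ℝ}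
    (hX : DifferentiableAt ℝ X z) (h : HasDerivAt (fun t => X (z.1, t)) X' z.2) :
    partialV X z = X' :=
  (HasFDerivAt.comp_hasDerivAt (x := z.2) (f := fun t : ℝ => (z.1, t)) hX.hasFDerivAt
    ((hasDerivAt_const z.2 z.1).prodMk (hasDerivAt_id z.2))).unique h

theorem partialU_congr {X Y : ℝ × ℝ → Fin 3 → ℝ} {U : Set (ℝ × ℝ)} (hU : IsOpen U)
    (h : ∀ z ∈ U, X z = Y z) {z : ℝ × ℝ} (hz : z ∈ U) : partialU X z = partialU Y z := by
  have : X =ᶠ[nhds z] Y := by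
    filter_upwards [hU.mem_nhds hz] with w hw using h w hw
  rw [partialU, partialU, this.fderiv_eq]

theorem partialV_congr {X Y : ℝ × ℝ → Fin 3 → ℝ} {U : Set (ℝ × ℝ)} (hU : IsOpen U)
    (h : ∀ z ∈ U, X z = Y z) {z : ℝ × ℝ} (hz : z ∈ U) : partialV X z = partialV Y z := by
  have : X =ᶠ[nhds z] Y := by
    filter_upwards [hU.mem_nhds hz] with w hw using h w hw
  rw [partialV, partialV, this.fderiv_eq]

theorem hasDerivAt_vec3 {f g h : ℝ → ℝ} {f' g' h' t : ℝ} (hf : HasDerivAt f f' t)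
    (hg : HasDerivAt g g' t) (hh : HasDerivAt h h' t) :
    HasDerivAt (fun t => ![f t, g t, h t]) ![f', g', h'] t :=
  hasDerivAt_pi.2 fun i => by fin_cases i <;> assumption

theorem contDiffOn_vec3 {E : Type*} [NormedAddCommGroup E] [NormedSpace ℝ E] {f g h : E → ℝ}
    {U : Set E} {n : WithTop ℕ∞} (hf : ContDiffOn ℝ n f U)
    (hg : ContDiffOn ℝ n g U) (hh : ContDiffOn ℝ n h U) :
    ContDiffOn ℝ n (fun t => ![f t, g t, h t]) U :=
  contDiffOn_pi.2 fun i => by fin_cases i <;> assumption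

/-! ### The hyperboloid -/

theorem contDiff_jacobiSn {m : ℝ} (hm : m ≠ 1) : ContDiff ℝ ∞ (jacobiSn m) := (contDiff_jacobi hm).1

theorem contDiff_jacobiCn {m : ℝ} (hm : m ≠ 1) : ContDiff ℝ ∞ (jacobiCn m) :=
  (contDiff_jacobi hm).2.1

theorem contDiff_jacobiDn {m : ℝ} (hm : m ≠ 1) : ContDiff ℝ ∞ (jacobiDn m) :=
  (contDiff_jacobi hm).2.2

theorem contDiffOn_hyperboloid (a b c : ℝ) {m : ℝ} (hm : m ≠ 1) {U : Set (ℝ × ℝ)}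
    (hU : U ⊆ regularSet m) : ContDiffOn ℝ ∞ (hyperboloid a b c m) U := by
  have hs := contDiff_jacobiSn hm
  have hc := contDiff_jacobiCn hm
  have hd := contDiff_jacobiDn hm
  unfold hyperboloid
  refine ContDiffOn.smul (contDiffOn_const.div (ContDiff.contDiffOn (by fun_prop))
    fun z hz => mul_ne_zero (hU hz).1 (hU hz).2.1) (contDiffOn_vec3 ?_ ?_ ?_) <;>
  exact ContDiff.contDiffOn (by fun_prop)

/-- The partial derivative of the hyperboloid in the direction of `u`. -/
noncomputable def hyperboloidU (a b c m : ℝ) (z : ℝ × ℝ) : Fin 3 → ℝ :=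
  (1 / (jacobiSn m z.1 ^ 2 * jacobiDn m z.2)) •
    ![-(a * jacobiDn m z.1), b * jacobiSn m z.2 * jacobiCn m z.1,
      -(c * jacobiCn m z.2 * jacobiCn m z.1 * jacobiDn m z.1)]

/-- The partial derivative of the hyperboloid in the direction of `v`. -/
noncomputable def hyperboloidV (a b c m : ℝ) (z : ℝ × ℝ) : Fin 3 → ℝ :=
  (1 / (jacobiSn m z.1 * jacobiDn m z.2 ^ 2)) •
    ![a * m * jacobiCn m z.1 * jacobiSn m z.2 * jacobiCn m z.2,
      -(b * jacobiDn m z.1 * jacobiCn m z.2), -(c * (1 - m) * jacobiSn m z.2)]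

theorem contDiffOn_hyperboloidV (a b c : ℝ) {m : ℝ} (hm : m ≠ 1) {U : Set (ℝ × ℝ)}
    (hU : U ⊆ regularSet m) : ContDiffOn ℝ ∞ (hyperboloidV a b c m) U := by
  have hs := contDiff_jacobiSn hm
  have hc := contDiff_jacobiCn hm
  have hd := contDiff_jacobiDn hm
  unfold hyperboloidV
  refine ContDiffOn.smul (contDiffOn_const.div (ContDiff.contDiffOn (by fun_prop))
    fun z hz => mul_ne_zero (hU hz).1 (pow_ne_zero 2 (hU hz).2.1)) (contDiffOn_vec3 ?_ ?_ ?_) <;>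
  exact ContDiff.contDiffOn (by fun_prop)

theorem partialU_hyperboloid (a b c : ℝ) {m : ℝ} (hm : m ≠ 1) {U : Set (ℝ × ℝ)} (hUo : IsOpen U)
    (hU : U ⊆ regularSet m) {z : ℝ × ℝ} (hz : z ∈ U) :
    partialU (hyperboloid a b c m) z = hyperboloidU a b c m z := by
  obtain ⟨u, v⟩ := z
  obtain ⟨h1, h2, -⟩ := hU hz
  dsimp only at h1 h2
  refine partialU_eq_of_hasDerivAt (((contDiffOn_hyperboloid a b c hm hU).contDiffAt
    (hUo.mem_nhds hz)).differentiableAt (by simp)) ?_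
  have hs := hasDerivAt_jacobiSn hm u
  have hc := hasDerivAt_jacobiCn hm u
  have hd := hasDerivAt_jacobiDn hm u
  have h := ((hasDerivAt_const u (1 : ℝ)).div (hs.mul_const (jacobiDn m v))
    (mul_ne_zero h1 h2)).smul (hasDerivAt_vec3 (hc.const_mul a)
      ((hd.const_mul (jacobiSn m v)).const_mul b).neg (hasDerivAt_const u (c * jacobiCn m v)))
  refine (h.congr_deriv ?_ : HasDerivAt (fun t => hyperboloid a b c m (t, v)) _ u)
  have c1 := jacobiCn_sq hm u
  have d1 := jacobiDn_sq m u
  ext i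
  fin_cases i <;> simp [hyperboloidU, -mul_eq_mul_left_iff, -mul_eq_mul_right_iff] <;>
    field_simp <;> grind

theorem partialV_hyperboloid (a b c : ℝ) {m : ℝ} (hm : m ≠ 1) {U : Set (ℝ × ℝ)} (hUo : IsOpen U)
    (hU : U ⊆ regularSet m) {z : ℝ × ℝ} (hz : z ∈ U) :
    partialV (hyperboloid a b c m) z = hyperboloidV a b c m z := by
  obtain ⟨u, v⟩ := z
  obtain ⟨h1, h2, -⟩ := hU hz
  dsimp only at h1 h2
  refine partialV_eq_of_hasDerivAt (((contDiffOn_hyperboloid a b c hm hU).contDiffAt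
    (hUo.mem_nhds hz)).differentiableAt (by simp)) ?_
  have hs := hasDerivAt_jacobiSn hm v
  have hc := hasDerivAt_jacobiCn hm v
  have hd := hasDerivAt_jacobiDn hm v
  have h := ((hasDerivAt_const v (1 : ℝ)).div (hd.const_mul (jacobiSn m u))
    (mul_ne_zero h1 h2)).smul (hasDerivAt_vec3 (hasDerivAt_const v (a * jacobiCn m u))
      ((hs.mul_const (jacobiDn m u)).const_mul b).neg (hc.const_mul c))
  refine (h.congr_deriv ?_ : HasDerivAt (fun t => hyperboloid a b c m (u, t)) _ v)
  have c1 := jacobiCn_sq hm v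
  have d1 := jacobiDn_sq m v
  ext i
  fin_cases i <;> simp [hyperboloidV, -mul_eq_mul_left_iff, -mul_eq_mul_right_iff] <;>
    field_simp <;> grind

theorem partialU_partialV_hyperboloid (a b c : ℝ) {m : ℝ} (hm : m ≠ 1) {U : Set (ℝ × ℝ)}
    (hUo : IsOpen U) (hU : U ⊆ regularSet m) {z : ℝ × ℝ} (hz : z ∈ U) :
    partialU (partialV (hyperboloid a b c m)) z =
      (1 / (jacobiSn m z.1 ^ 2 * jacobiDn m z.2 ^ 2)) •
        ![-(a * m * jacobiDn m z.1 * jacobiSn m z.2 * jacobiCn m z.2),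
          b * jacobiCn m z.1 * jacobiCn m z.2,
          c * (1 - m) * jacobiSn m z.2 * jacobiCn m z.1 * jacobiDn m z.1] := by
  rw [partialU_congr hUo (fun w hw => partialV_hyperboloid a b c hm hUo hU hw) hz]
  obtain ⟨u, v⟩ := z
  obtain ⟨h1, h2, -⟩ := hU hz
  dsimp only at h1 h2
  refine partialU_eq_of_hasDerivAt (((contDiffOn_hyperboloidV a b c hm hU).contDiffAt
    (hUo.mem_nhds hz)).differentiableAt (by simp)) ?_
  have hs := hasDerivAt_jacobiSn hm u
  have hc := hasDerivAt_jacobiCn hm u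
  have hd := hasDerivAt_jacobiDn hm u
  have h := ((hasDerivAt_const u (1 : ℝ)).div (hs.mul_const (jacobiDn m v ^ 2))
    (mul_ne_zero h1 (pow_ne_zero 2 h2))).smul (hasDerivAt_vec3
      (((hc.const_mul (a * m)).mul_const (jacobiSn m v)).mul_const (jacobiCn m v))
      ((hd.const_mul b).mul_const (jacobiCn m v)).neg
      (hasDerivAt_const u (-(c * (1 - m) * jacobiSn m v))))
  refine (h.congr_deriv ?_ : HasDerivAt (fun t => hyperboloidV a b c m (t, v)) _ u)
  have c1 := jacobiCn_sq hm u
  have d1 := jacobiDn_sq m u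
  ext i
  fin_cases i <;> simp [-mul_eq_mul_left_iff, -mul_eq_mul_right_iff] <;>
    field_simp <;> grind

theorem hyperboloid_mem_quadric {a b c m : ℝ} (ha : a ≠ 0) (hb : b ≠ 0) (hc : c ≠ 0) (hm : m ≠ 1)
    {z : ℝ × ℝ} (hz : z ∈ regularSet m) :
    -(hyperboloid a b c m z 0 / a) ^ 2 + (hyperboloid a b c m z 1 / b) ^ 2
      + (hyperboloid a b c m z 2 / c) ^ 2 = 1 := by
  obtain ⟨u, v⟩ := z
  obtain ⟨h1, h2, -⟩ := hz
  dsimp only at h1 h2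
  have c1 := jacobiCn_sq hm u
  have d1 := jacobiDn_sq m u
  have c2 := jacobiCn_sq hm v
  have d2 := jacobiDn_sq m v
  simp [hyperboloid]
  field_simp
  grind

theorem linearIndependent_hyperboloid {a b c m : ℝ} (ha : a ≠ 0) (hb : b ≠ 0) (hc : c ≠ 0)
    (hm : m ≠ 1) {z : ℝ × ℝ} (hz : z ∈ regularSet m) :
    LinearIndependent ℝ ![hyperboloidU a b c m z, hyperboloidV a b c m z] := by
  obtain ⟨u, v⟩ := z
  obtain ⟨h1, h2, h3, h4⟩ := hz
  dsimp only at h1 h2 h3 h4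
  have hD := jacobiDnProd_ne_zero hm h3 h4
  have hDe := jacobiDnProd.eq_1 m u v
  have c1 := jacobiCn_sq hm u
  have d1 := jacobiDn_sq m u
  have c2 := jacobiCn_sq hm v
  have d2 := jacobiDn_sq m v
  rw [LinearIndependent.pair_iff]
  intro s t hst
  have e0 := congrFun hst 0
  have e1 := congrFun hst 1
  have e2 := congrFun hst 2
  simp only [hyperboloidU, hyperboloidV, Pi.add_apply, Pi.smul_apply, smul_eq_mul,
    Matrix.cons_val, Pi.zero_apply] at e0 e1 e2
  have hsu : s = s * (1 / (jacobiSn m u ^ 2 * jacobiDn m v)) * (jacobiSn m u ^ 2 * jacobiDn m v) := by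
    field_simp
  have htu : t = t * (1 / (jacobiSn m u * jacobiDn m v ^ 2)) * (jacobiSn m u * jacobiDn m v ^ 2) := by
    field_simp
  rw [← mul_assoc] at e0 e1 e2
  rw [← mul_assoc t] at e0 e1 e2
  generalize s * (1 / (jacobiSn m u ^ 2 * jacobiDn m v)) = σ at *
  generalize t * (1 / (jacobiSn m u * jacobiDn m v ^ 2)) = τ at *
  generalize jacobiDnProd m u v = D at *
  replace e0 : -σ * jacobiDn m u + τ * (m * jacobiCn m u * jacobiSn m v * jacobiCn m v) = 0 :=
    mul_left_cancel₀ ha (by linear_combination e0)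
  replace e1 : σ * (jacobiSn m v * jacobiCn m u) - τ * (jacobiDn m u * jacobiCn m v) = 0 :=
    mul_left_cancel₀ hb (by linear_combination e1)
  replace e2 : -σ * (jacobiCn m v * jacobiCn m u * jacobiDn m u) - τ * ((1 - m) * jacobiSn m v) = 0 :=
    mul_left_cancel₀ hc (by linear_combination e2)
  generalize jacobiSn m u = S₁, jacobiCn m u = C₁, jacobiDn m u = D₁,
    jacobiSn m v = S₂, jacobiCn m v = C₂, jacobiDn m v = D₂ at *
  -- The three equations in σ, τ have the 2×2 minors C₂D, D₁S₂D and C₁D up to sign. Their cofactors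
  -- of D cannot all vanish: C₁ = C₂ = 0 gives D₁² = 1 - m ≠ 0 and S₂² = 1.
  have key : C₂ ≠ 0 ∨ D₁ * S₂ ≠ 0 ∨ C₁ ≠ 0 := by
    by_contra! h
    obtain ⟨h5, h6, h7⟩ := h
    have : D₁ ^ 2 = 1 - m := by grind
    have : D₁ ≠ 0 := by rintro rfl; exact hm (by linarith)
    grind
  have p1 : σ * (C₂ * D) = 0 ∧ τ * (C₂ * D) = 0 := by constructor <;> grind
  have p2 : σ * (D₁ * S₂ * D) = 0 ∧ τ * (D₁ * S₂ * D) = 0 := by constructor <;> grind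
  have p3 : σ * (C₁ * D) = 0 ∧ τ * (C₁ * D) = 0 := by constructor <;> grind
  have : σ = 0 ∧ τ = 0 := by
    rcases key with h | h | h
    · simpa [h, hD] using p1
    · simpa [h, hD, mul_eq_zero.not.1 h] using p2
    · simpa [h, hD] using p3
  rw [hsu, htu, this.1, this.2]
  simp

theorem isCurvatureLineParametrization_hyperboloid {a b c m : ℝ} (ha : a ≠ 0) (hb : b ≠ 0)
    (hc : c ≠ 0) (hm : m ≠ 1) (habc : m * (a ^ 2 - c ^ 2) = b ^ 2 - c ^ 2) {U : Set (ℝ × ℝ)}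
    (hUo : IsOpen U) (hU : U ⊆ regularSet m) :
    IsCurvatureLineParametrization (hyperboloid a b c m) U where
  immersed := ⟨contDiffOn_hyperboloid a b c hm hU, fun z hz => by
    rw [partialU_hyperboloid a b c hm hUo hU hz, partialV_hyperboloid a b c hm hUo hU hz]
    exact linearIndependent_hyperboloid ha hb hc hm (hU hz)⟩
  orthogonal z hz := by
    rw [partialU_hyperboloid a b c hm hUo hU hz, partialV_hyperboloid a b c hm hUo hU hz]
    simp only [mink, hyperboloidU, hyperboloidV, Pi.smul_apply, smul_eq_mul, Matrix.cons_val]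
    linear_combination (1 / (jacobiSn m z.1 ^ 2 * jacobiDn m z.2) *
      (1 / (jacobiSn m z.1 * jacobiDn m z.2 ^ 2)) * jacobiDn m z.1 * jacobiCn m z.1 *
      jacobiSn m z.2 * jacobiCn m z.2) * habc
  conjugate z hz := by
    rw [partialU_partialV_hyperboloid a b c hm hUo hU hz,
      partialU_hyperboloid a b c hm hUo hU hz, partialV_hyperboloid a b c hm hUo hU hz]
    obtain ⟨u, v⟩ := z
    obtain ⟨h1, h2, h3, h4⟩ := hU hz
    dsimp only at h1 h2 h3 h4 ⊢
    have hD := jacobiDnProd_ne_zero hm h3 h4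
    have hDe := jacobiDnProd.eq_1 m u v
    have c1 := jacobiCn_sq hm u
    have d1 := jacobiDn_sq m u
    have c2 := jacobiCn_sq hm v
    have d2 := jacobiDn_sq m v
    -- The coefficients solve X_uv = l X_u + k X_v by Cramer's rule; the denominator D is the common
    -- factor of the minors of (X_u, X_v).
    refine ⟨m * (1 - m) * jacobiSn m u ^ 2 * jacobiSn m v * jacobiCn m v /
      (jacobiDnProd m u v * jacobiDn m v),
      -(jacobiCn m u * jacobiDn m u * jacobiDn m v ^ 2) / (jacobiDnProd m u v * jacobiSn m u), ?_⟩
    simp only [hyperboloidU, hyperboloidV]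
    generalize jacobiDnProd m u v = D, jacobiSn m u = S₁, jacobiCn m u = C₁, jacobiDn m u = D₁,
      jacobiSn m v = S₂, jacobiCn m v = C₂, jacobiDn m v = D₂ at *
    ext i
    fin_cases i <;> simp [-mul_eq_mul_left_iff, -mul_eq_mul_right_iff] <;> field_simp <;>
      clear * - c1 d1 c2 d2 hDe <;> grind

/-! ### Primitives -/

theorem Complex.eq_ofReal_or_eq_ofReal_mul_I_of_sq {η : ℂ} {r : ℝ} (h : η ^ 2 = r) :
    (∃ τ : ℝ, η = τ) ∨ ∃ τ : ℝ, η = τ * Complex.I := by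
  have him := congrArg Complex.im h
  rw [sq, Complex.mul_im, Complex.ofReal_im] at him
  have : η.re = 0 ∨ η.im = 0 := by
    rw [← mul_eq_zero]; linarith
  rcases this with h0 | h0
  · exact Or.inr ⟨η.im, by apply Complex.ext <;> simp [h0]⟩
  · exact Or.inl ⟨η.re, by apply Complex.ext <;> simp [h0]⟩

/-- Since η² is real, η is real or purely imaginary. In the first case this is the real arctangent.
In the second, the real part of the complex logarithm is the logarithm of an absolute value, so the
derivative formula holds on both sides of the singularities, whatever the branch. -/
theorem hasDerivAt_re_mul_arctan {κ η : ℂ} {r s : ℝ} (hω : η ^ 2 = r) (hκ : κ * η = s)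
    (h0 : η ≠ 0) {x : ℝ} (hx : 1 + r * x ^ 2 ≠ 0) :
    HasDerivAt (fun x : ℝ => (κ * Complex.arctan (η * x)).re) (s / (1 + r * x ^ 2)) x := by
  have hκ' : κ = s / η := by rw [eq_div_iff h0, hκ]
  rcases Complex.eq_ofReal_or_eq_ofReal_mul_I_of_sq hω with ⟨τ, rfl⟩ | ⟨τ, rfl⟩
  · have hr : r = τ ^ 2 := by exact_mod_cast hω.symm
    have hτ : τ ≠ 0 := by exact_mod_cast h0
    have e : (fun x : ℝ => (κ * Complex.arctan (τ * x)).re) =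
        fun x => s / τ * Real.arctan (τ * x) := by
      funext x
      rw [hκ', ← Complex.ofReal_mul, ← Complex.ofReal_arctan, ← Complex.ofReal_div,
        ← Complex.ofReal_mul, Complex.ofReal_re]
    rw [e]
    refine (((hasDerivAt_id x).const_mul τ).arctan.const_mul (s / τ)).congr_deriv ?_
    rw [hr] at hx ⊢
    simp only [id]
    rw [← mul_pow] at hx ⊢
    field_simp
  · have hτ : τ ≠ 0 := by rintro rfl; simp at h0
    have hr : r = -τ ^ 2 := by
      rw [mul_pow, Complex.I_sq] at hω
      have : ((-τ ^ 2 : ℝ) : ℂ) = r := by rw [← hω]; push_cast; ring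
      exact_mod_cast this.symm
    have e : (fun x : ℝ => (κ * Complex.arctan (τ * Complex.I * x)).re) =
        fun x => -(s / (2 * τ)) * Real.log ((1 - τ * x) / (1 + τ * x)) := by
      funext x
      have e1 : κ * Complex.arctan (τ * Complex.I * x) =
          ((-(s / (2 * τ)) : ℝ) : ℂ) * Complex.log (((1 - τ * x) / (1 + τ * x) : ℝ) : ℂ) := by
        have e2 : (1 + τ * Complex.I * x * Complex.I) / (1 - τ * Complex.I * x * Complex.I) =
            (((1 - τ * x) / (1 + τ * x) : ℝ) : ℂ) := by
          push_cast
          congr 1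
          · linear_combination (↑τ * ↑x : ℂ) * Complex.I_sq
          · linear_combination (-(↑τ * ↑x) : ℂ) * Complex.I_sq
        rw [Complex.arctan, e2, hκ']
        push_cast
        field_simp
      rw [e1, Complex.re_ofReal_mul, Complex.log_ofReal_re]
    rw [e]
    have hx' : (1 - τ * x) * (1 + τ * x) ≠ 0 := by rw [hr] at hx; convert hx using 1; ring
    obtain ⟨h1, h2⟩ := mul_ne_zero_iff.1 hx'
    have hlin := (hasDerivAt_id x).const_mul τ
    refine ((((hlin.const_sub 1).div (hlin.const_add 1) h2).log
      (div_ne_zero h1 h2)).const_mul (-(s / (2 * τ)))).congr_deriv ?_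
    have hr' : 1 + r * x ^ 2 = (1 - τ * x) * (1 + τ * x) := by rw [hr]; ring
    rw [hr']
    simp only [id, Pi.div_apply]
    field_simp
    ring

/-- Both sides involve the logarithm of the same quotient, so the principal branches agree exactly
and `cnPrimitive` falls under `hasDerivAt_re_mul_arctan`. -/
theorem complexArtanh_eq (w : ℂ) :
    complexArtanh w = Complex.I * Complex.arctan (-Complex.I * w) := by
  have e : ∀ z : ℂ, -Complex.I * z * Complex.I = z := fun z => by
    linear_combination (-z) * Complex.I_sq
  rw [complexArtanh, Complex.arctan, e]
  linear_combination ((1 / 2) * Complex.log ((1 + w) / (1 - w))) * Complex.I_sq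

/-- The primitive of `2 / dn` in the explicit formula. -/
noncomputable def timePrimitive (m : ℝ) (p : ℂ) (t : ℝ) : ℝ :=
  (-(2 / p) * Complex.arctan (jacobiCn m t * (p * jacobiSn m t)⁻¹)).re

/-- The primitive of `-2 sn / dn` in the explicit formula. -/
noncomputable def snPrimitive (m : ℝ) (p q : ℂ) (t : ℝ) : ℝ :=
  (2 / (p * q) * Complex.arctan (q / p * jacobiCn m t)).re

/-- The primitive of `2 cn / dn` in the explicit formula. -/
noncomputable def cnPrimitive (m : ℝ) (q : ℂ) (t : ℝ) : ℝ :=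
  (2 / q * complexArtanh (q * jacobiSn m t)).re

theorem hasDerivAt_timePrimitive {m : ℝ} (hm : m ≠ 1) {p : ℂ} (hp : p ^ 2 = ((1 - m : ℝ) : ℂ))
    {t : ℝ} (hd : jacobiDn m t ≠ 0) (hs : jacobiSn m t ≠ 0) :
    HasDerivAt (timePrimitive m p) (2 / jacobiDn m t) t := by
  have hm' : (1 - m) ≠ 0 := sub_ne_zero.2 hm.symm
  have hp0 : p ≠ 0 := by
    rintro rfl
    exact hm' (by exact_mod_cast (by simpa using hp.symm : ((1 - m : ℝ) : ℂ) = 0))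
  have hω : p⁻¹ ^ 2 = (((1 - m)⁻¹ : ℝ) : ℂ) := by rw [inv_pow, hp, Complex.ofReal_inv]
  have hκ : -(2 / p) * p⁻¹ = ((-2 * (1 - m)⁻¹ : ℝ) : ℂ) := by
    rw [Complex.ofReal_mul, ← hω]; push_cast; ring
  have c1 := jacobiCn_sq hm t
  have d1 := jacobiDn_sq m t
  have key : jacobiSn m t ^ 2 * (1 - m) + jacobiCn m t ^ 2 = jacobiDn m t ^ 2 := by
    rw [c1, d1]; ring
  have hx : 1 + (1 - m)⁻¹ * (jacobiCn m t / jacobiSn m t) ^ 2 =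
      jacobiDn m t ^ 2 / ((1 - m) * jacobiSn m t ^ 2) := by
    rw [← key]; field_simp
  have h := HasDerivAt.comp t (hasDerivAt_re_mul_arctan hω hκ (inv_ne_zero hp0)
    (x := jacobiCn m t / jacobiSn m t) (by rw [hx]; positivity))
    ((hasDerivAt_jacobiCn hm t).div (hasDerivAt_jacobiSn hm t) hs)
  rw [hx] at h
  refine (h.congr_of_eventuallyEq (Filter.Eventually.of_forall fun y => ?_)).congr_deriv ?_
  · simp only [timePrimitive, Function.comp, Pi.div_apply, Complex.ofReal_div]
    congr 3
    rw [mul_inv]; ring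
  · field_simp
    linear_combination c1

theorem hasDerivAt_snPrimitive {m : ℝ} (hm : m ≠ 1) {p q : ℂ} (hp : p ^ 2 = ((1 - m : ℝ) : ℂ))
    (hq : q ^ 2 = m) (hq0 : q ≠ 0) {t : ℝ} (hd : jacobiDn m t ≠ 0) :
    HasDerivAt (snPrimitive m p q) (-(2 * jacobiSn m t / jacobiDn m t)) t := by
  have hm' : (1 - m) ≠ 0 := sub_ne_zero.2 hm.symm
  have hp0 : p ≠ 0 := by
    rintro rfl
    exact hm' (by exact_mod_cast (by simpa using hp.symm : ((1 - m : ℝ) : ℂ) = 0))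
  have hω : (q / p) ^ 2 = ((m / (1 - m) : ℝ) : ℂ) := by rw [div_pow, hp, hq, Complex.ofReal_div]
  have hκ : 2 / (p * q) * (q / p) = ((2 * (1 - m)⁻¹ : ℝ) : ℂ) := by
    rw [Complex.ofReal_mul, Complex.ofReal_inv, ← hp]; push_cast; field_simp
  have c1 := jacobiCn_sq hm t
  have d1 := jacobiDn_sq m t
  have hx : 1 + m / (1 - m) * jacobiCn m t ^ 2 = jacobiDn m t ^ 2 / (1 - m) := by
    rw [c1, d1]; field_simp; ring
  have h := HasDerivAt.comp t (hasDerivAt_re_mul_arctan hω hκ (div_ne_zero hq0 hp0)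
    (x := jacobiCn m t) (by rw [hx]; positivity)) (hasDerivAt_jacobiCn hm t)
  rw [hx] at h
  refine HasDerivAt.congr_deriv h ?_
  field_simp

theorem hasDerivAt_cnPrimitive {m : ℝ} (hm : m ≠ 1) {q : ℂ}
    (hq : q ^ 2 = m) (hq0 : q ≠ 0) {t : ℝ} (hd : jacobiDn m t ≠ 0) :
    HasDerivAt (cnPrimitive m q) (2 * jacobiCn m t / jacobiDn m t) t := by
  have hω : (-Complex.I * q) ^ 2 = ((-m : ℝ) : ℂ) := by
    rw [mul_pow, neg_sq, Complex.I_sq, hq]; push_cast; ring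
  have hκ : 2 / q * Complex.I * (-Complex.I * q) = ((2 : ℝ) : ℂ) := by
    field_simp
    rw [Complex.I_sq]; simp
  have hx : 1 + -m * jacobiSn m t ^ 2 = jacobiDn m t ^ 2 := by rw [jacobiDn_sq]; ring
  have h := HasDerivAt.comp t (hasDerivAt_re_mul_arctan hω hκ (by simp [hq0])
    (x := jacobiSn m t) (by rw [hx]; positivity)) (hasDerivAt_jacobiSn hm t)
  rw [hx] at h
  refine (h.congr_of_eventuallyEq (Filter.Eventually.of_forall fun y => ?_)).congr_deriv ?_
  · simp only [cnPrimitive, Function.comp, complexArtanh_eq, mul_assoc]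
  · field_simp

/-- `timePrimitive` is controlled only where sn ≠ 0, whereas S must be smooth on all of U. For m <
1, dn has no zeros and an integral serves. For m > 1, cn has no zeros, and (2/p) arctan(p sn/cn)
with p² = 1 - m replaces the formula in cn/sn. -/
theorem exists_primitive_two_div_jacobiDn {m : ℝ} (hm : m ≠ 1) :
    ∃ g : ℝ → ℝ, ∀ t, jacobiDn m t ≠ 0 → HasDerivAt g (2 / jacobiDn m t) t := by
  rcases hm.lt_or_gt with h | h
  · refine ⟨fun t => ∫ s in (0 : ℝ)..t, 2 / jacobiDn m s, fun t _ => ?_⟩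
    refine (Continuous.integral_hasStrictDerivAt ?_ 0 t).hasDerivAt
    exact continuous_const.div (contDiff_jacobiDn hm).continuous fun s => (jacobiDn_pos h s).ne'
  · have hm' : (1 - m) ≠ 0 := sub_ne_zero.2 hm.symm
    have hp : ((√(m - 1) : ℂ) * Complex.I) ^ 2 = ((1 - m : ℝ) : ℂ) := by
      rw [mul_pow, Complex.I_sq, ← Complex.ofReal_pow, Real.sq_sqrt (by linarith)]
      push_cast; ring
    generalize (√(m - 1) : ℂ) * Complex.I = p at hp
    have hp0 : p ≠ 0 := by
      rintro rfl
      exact hm' (by exact_mod_cast (by simpa using hp.symm : ((1 - m : ℝ) : ℂ) = 0))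
    refine ⟨fun t => (2 / p * Complex.arctan (p * (jacobiSn m t / jacobiCn m t : ℝ))).re,
      fun t hd => ?_⟩
    have hc := (jacobiCn_pos h t).ne'
    have c1 := jacobiCn_sq hm t
    have d1 := jacobiDn_sq m t
    have hx : 1 + (1 - m) * (jacobiSn m t / jacobiCn m t) ^ 2 =
        jacobiDn m t ^ 2 / jacobiCn m t ^ 2 := by
      field_simp
      rw [c1, d1]; ring
    have h := HasDerivAt.comp t (hasDerivAt_re_mul_arctan hp (κ := 2 / p) (s := 2)
      (by rw [div_mul_cancel₀ _ hp0]; norm_num) hp0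
      (x := jacobiSn m t / jacobiCn m t) (by rw [hx]; positivity))
      ((hasDerivAt_jacobiSn hm t).div (hasDerivAt_jacobiCn hm t) hc)
    rw [hx] at h
    refine HasDerivAt.congr_deriv h ?_
    field_simp
    linear_combination c1

/-! ### Evaluation of the explicit formula -/

/-- A surface given in null coordinates `u + v`, `u - v`. -/
def waveSurface (P Q : ℝ → Fin 3 → ℝ) (z : ℝ × ℝ) : Fin 3 → ℝ := P (z.1 + z.2) + Q (z.1 - z.2)

/-- The surface with the null directions `(g₁', ±g₂', g₃')`. -/
noncomputable def conjugateSurface (g₁ g₂ g₃ : ℝ → ℝ) : ℝ × ℝ → Fin 3 → ℝ :=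
  waveSurface (fun t => ![g₁ t / 2, g₂ t / 2, g₃ t / 2])
    (fun t => ![g₁ t / 2, -(g₂ t / 2), g₃ t / 2])

/-- The element with the components `x`, `y` with respect to the null idempotents. -/
noncomputable def paraPair (x y : ℂ) : ParaComplex ℂ :=
  x • (⟨1 / 2, 1 / 2⟩ : ParaComplex ℂ) + y • (⟨1 / 2, -(1 / 2)⟩ : ParaComplex ℂ)

theorem paraPair_re (x y : ℂ) : (paraPair x y).re = (x + y) / 2 := by
  simp [paraPair]; ring

theorem paraPair_im (x y : ℂ) : (paraPair x y).im = (x - y) / 2 := by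
  simp [paraPair]; ring

theorem paraExt_eq_paraPair (f : ℝ → ℂ) (z : ParaComplex ℝ) :
    paraExt f z = paraPair (f (z.re + z.im)) (f (z.re - z.im)) := rfl

/-- In the idempotent basis, extended functions act on each component separately, and so does
multiplication (`paraPair_mul`), with j acting as (1, -1). Hence the whole formula can be evaluated
at u+v and u-v independently. -/
theorem paraExt_paraPair (f : ℂ → ℂ) (x y : ℂ) :
    paraExt f (paraPair x y) = paraPair (f x) (f y) := by
  have h₁ : (paraPair x y).re + (paraPair x y).im = x := by rw [paraPair_re, paraPair_im]; ring
  have h₂ : (paraPair x y).re - (paraPair x y).im = y := by rw [paraPair_re, paraPair_im]; ring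
  rw [paraExt, h₁, h₂, paraPair]

theorem smul_paraPair (k x y : ℂ) : k • paraPair x y = paraPair (k * x) (k * y) := by
  simp only [paraPair, smul_add, smul_smul]

theorem paraPair_mul (x y x' y' : ℂ) :
    paraPair x y * paraPair x' y' = paraPair (x * x') (y * y') := by
  ext <;> (simp [paraPair_re, paraPair_im]; ring)

theorem paraJ_mul_paraPair (x y : ℂ) : paraJ ℂ * paraPair x y = paraPair x (-y) := by
  ext <;> (simp [paraPair_re, paraPair_im, paraJ]; try ring)

theorem dualFormula_eq (a b c m : ℝ) (p q : ℂ) (z : ℝ × ℝ) :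
    dualFormula a b c m p q ⟨z.1, z.2⟩ = axisScaling a b c
      (conjugateSurface (timePrimitive m p) (snPrimitive m p q) (cnPrimitive m q) z) := by
  have key : ∀ (k : ℝ) (e x y : ℂ), ((k * e * x + k * e * y) / 2).re =
      k * ((e * x).re / 2 + (e * y).re / 2) := fun k e x y => by
    rw [show (k * e * x + k * e * y) / 2 = ((k / 2 : ℝ) : ℂ) * (e * x) + ((k / 2 : ℝ) : ℂ) * (e * y)
      by push_cast; ring, Complex.add_re, Complex.re_ofReal_mul, Complex.re_ofReal_mul]
    ring
  have h₁ : (-(2 * a / p) : ℂ) = a * -(2 / p) := by ring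
  have h₂ : (2 * b / (p * q) : ℂ) = b * (2 / (p * q)) := by ring
  have h₃ : (2 * c / q : ℂ) = c * (2 / q) := by ring
  simp only [dualFormula, paraSn, paraCn, paraInv, paraArctan, paraArtanh, paraRe,
    paraExt_eq_paraPair, smul_paraPair, paraExt_paraPair, paraPair_mul, paraJ_mul_paraPair,
    paraPair_re, h₁, h₂, h₃, axisScaling, conjugateSurface, waveSurface, Pi.add_apply,
    Matrix.cons_val, timePrimitive, snPrimitive, cnPrimitive, ← mul_neg, key]
  simp only [mul_neg, Complex.neg_re, neg_div]

/-! ### Christoffel duality -/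

theorem differentiableAt_partialU {X : ℝ × ℝ → Fin 3 → ℝ} {U : Set (ℝ × ℝ)} (hU : IsOpen U)
    (hX : ContDiffOn ℝ ∞ X U) {z : ℝ × ℝ} (hz : z ∈ U) : DifferentiableAt ℝ (partialU X) z :=
  (((((contDiffOn_infty_iff_fderiv_of_isOpen hU).1 hX).2).contDiffAt (hU.mem_nhds hz)).differentiableAt
    (by simp)).clm_apply (differentiableAt_const _)

theorem differentiableAt_partialV {X : ℝ × ℝ → Fin 3 → ℝ} {U : Set (ℝ × ℝ)} (hU : IsOpen U)
    (hX : ContDiffOn ℝ ∞ X U) {z : ℝ × ℝ} (hz : z ∈ U) : DifferentiableAt ℝ (partialV X) z :=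
  (((((contDiffOn_infty_iff_fderiv_of_isOpen hU).1 hX).2).contDiffAt (hU.mem_nhds hz)).differentiableAt
    (by simp)).clm_apply (differentiableAt_const _)

/-- Only the conjugacy of Y needs an argument: differentiating Y_v = -ρX_v in u gives Y_uv = -ρX_uv
- ρ_u X_v, which is tangent because X_uv is. -/
theorem isChristoffelDual_of_partial {X Y : ℝ × ℝ → Fin 3 → ℝ} {U : Set (ℝ × ℝ)} (hU : IsOpen U)
    (hX : IsCurvatureLineParametrization X U) (hY : ContDiffOn ℝ ∞ Y U) {ρ : ℝ × ℝ → ℝ}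
    (hρ : ∀ z ∈ U, DifferentiableAt ℝ ρ z) (hρ₀ : ∀ z ∈ U, ρ z ≠ 0)
    (hYu : ∀ z ∈ U, partialU Y z = ρ z • partialU X z)
    (hYv : ∀ z ∈ U, partialV Y z = -ρ z • partialV X z) : IsChristoffelDual X Y U where
  left := hX
  right :=
    { immersed := ⟨hY, fun z hz => by
        rw [hYu z hz, hYv z hz, LinearIndependent.pair_iff]
        intro s t hst
        rw [smul_smul, smul_smul] at hst
        have := LinearIndependent.pair_iff.1 (hX.immersed.2 z hz) _ _ hst
        simpa [hρ₀ z hz] using this⟩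
      orthogonal := fun z hz => by
        have := hX.orthogonal z hz
        rw [hYu z hz, hYv z hz]
        simp only [mink, Pi.smul_apply, smul_eq_mul] at this ⊢
        linear_combination (-ρ z ^ 2) * this
      conjugate := fun z hz => by
        obtain ⟨l, k, h⟩ := hX.conjugate z hz
        have h1 : partialU (partialV Y) z = (-ρ z) • partialU (partialV X) z +
            (fderiv ℝ (fun w => -ρ w) z (1, 0)) • partialV X z := by
          rw [partialU_congr hU hYv hz, partialU,
            fderiv_fun_smul (hρ z hz).fun_neg (differentiableAt_partialV hU hX.immersed.1 hz)]
          rfl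
        refine ⟨-l, k - (fderiv ℝ (fun w => -ρ w) z (1, 0)) / ρ z, ?_⟩
        rw [h1, h, hYu z hz, hYv z hz]
        have := hρ₀ z hz
        ext i
        simp only [Pi.add_apply, Pi.smul_apply, smul_eq_mul]
        field_simp
        ring }
  dual := ⟨ρ, fun z hz => ⟨hρ₀ z hz, hYu z hz, hYv z hz⟩⟩

theorem fderiv_eq_smul_of_partial {X Y : ℝ × ℝ → Fin 3 → ℝ} {z : ℝ × ℝ} {k : ℝ}
    (hu : partialU Y z = k • partialU X z) (hv : partialV Y z = k • partialV X z) :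
    fderiv ℝ Y z = k • fderiv ℝ X z := by
  refine ContinuousLinearMap.ext fun h => ?_
  have e : h = h.1 • ((1, 0) : ℝ × ℝ) + h.2 • ((0, 1) : ℝ × ℝ) := by ext <;> simp
  have hu' : fderiv ℝ Y z (1, 0) = k • fderiv ℝ X z (1, 0) := hu
  have hv' : fderiv ℝ Y z (0, 1) = k • fderiv ℝ X z (0, 1) := hv
  rw [e]
  simp only [map_add, map_smul, smul_apply, hu', hv']

/-- Two surfaces with pointwise proportional differentials are homothetic. -/
theorem exists_eq_smul_add_of_partial {X Y : ℝ × ℝ → Fin 3 → ℝ} {U : Set (ℝ × ℝ)} (hU : IsOpen U)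
    (hUc : IsPreconnected U) (hX : IsImmersedSurface X U) (hY : ContDiffOn ℝ ∞ Y U)
    {k : ℝ × ℝ → ℝ} (hk : ∀ z ∈ U, k z ≠ 0) (hu : ∀ z ∈ U, partialU Y z = k z • partialU X z)
    (hv : ∀ z ∈ U, partialV Y z = k z • partialV X z) :
    ∃ (κ : ℝ) (t : Fin 3 → ℝ), κ ≠ 0 ∧ ∀ z ∈ U, Y z = κ • X z + t := by
  rcases U.eq_empty_or_nonempty with rfl | ⟨z₀, hz₀⟩
  · exact ⟨1, 0, one_ne_zero, fun z hz => hz.elim⟩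
  have hXd : ∀ z ∈ U, DifferentiableAt ℝ X z := fun z hz =>
    (hX.1.contDiffAt (hU.mem_nhds hz)).differentiableAt (by simp)
  have hYd : ∀ z ∈ U, DifferentiableAt ℝ Y z := fun z hz =>
    (hY.contDiffAt (hU.mem_nhds hz)).differentiableAt (by simp)
  have hfd : ∀ z ∈ U, fderiv ℝ Y z = k z • fderiv ℝ X z := fun z hz =>
    fderiv_eq_smul_of_partial (hu z hz) (hv z hz)
  have hX2 : ∀ z ∈ U, DifferentiableAt ℝ (fderiv ℝ X) z := fun z hz =>
    ((((contDiffOn_infty_iff_fderiv_of_isOpen hU).1 hX.1).2).contDiffAt (hU.mem_nhds hz)).differentiableAt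
      (by simp)
  have hkd : ∀ z ∈ U, DifferentiableAt ℝ k z := fun z hz => by
    -- The function k is not assumed differentiable. Some component of X_u is nonzero at z, and near
    -- z the function k is a quotient of components of Y_u and X_u.
    obtain ⟨i, hi⟩ := Function.ne_iff.1 ((hX.2 z hz).ne_zero 0)
    have hi' : partialU X z i ≠ 0 := hi
    have d1 : DifferentiableAt ℝ (fun w => partialU X w i) z :=
      differentiableAt_pi.1 (differentiableAt_partialU hU hX.1 hz) i
    have d2 : DifferentiableAt ℝ (fun w => partialU Y w i) z :=
      differentiableAt_pi.1 (differentiableAt_partialU hU hY hz) i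
    have d3 : DifferentiableAt ℝ (fun w => partialU Y w i / partialU X w i) z := by
      simp only [div_eq_mul_inv]
      exact d2.fun_mul (d1.fun_inv hi')
    refine d3.congr_of_eventuallyEq ?_
    filter_upwards [d1.continuousAt.eventually_ne hi', hU.mem_nhds hz] with w hw hwU
    rw [eq_div_iff hw, hu w hwU, Pi.smul_apply, smul_eq_mul]
  have hsmooth : minSmoothness ℝ 2 ≤ ∞ := by
    rw [minSmoothness_of_isRCLikeNormedField]
    exact WithTop.coe_le_coe.2 (le_top : (2 : ℕ∞) ≤ ⊤)
  have hk0 : Set.EqOn (fderiv ℝ k) 0 U := fun z hz => by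
    have h2 : fderiv ℝ (fderiv ℝ Y) z =
        k z • fderiv ℝ (fderiv ℝ X) z + (fderiv ℝ k z).smulRight (fderiv ℝ X z) := by
      rw [← fderiv_fun_smul (hkd z hz) (hX2 z hz)]
      refine Filter.EventuallyEq.fderiv_eq ?_
      filter_upwards [hU.mem_nhds hz] with w hw using hfd w hw
    have sX := (hX.1.contDiffAt (hU.mem_nhds hz)).isSymmSndFDerivAt hsmooth (1, 0) (0, 1)
    have sY := (hY.contDiffAt (hU.mem_nhds hz)).isSymmSndFDerivAt hsmooth (1, 0) (0, 1)
    rw [h2] at sY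
    simp only [add_apply, smul_apply, sX,
      ContinuousLinearMap.smulRight_apply, add_right_inj] at sY
    -- Comparing the two mixed derivatives of Y leaves k_u X_v = k_v X_u, so both coefficients
    -- vanish.
    have h3 := LinearIndependent.pair_iff.1 (hX.2 z hz) (-fderiv ℝ k z (0, 1))
      (fderiv ℝ k z (1, 0)) (by
        rw [partialU, partialV, sY, neg_smul, neg_add_cancel])
    refine ContinuousLinearMap.ext fun h => ?_
    have e : h = h.1 • ((1, 0) : ℝ × ℝ) + h.2 • ((0, 1) : ℝ × ℝ) := by ext <;> simp
    rw [e, map_add, map_smul, map_smul, h3.2, neg_eq_zero.1 h3.1]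
    simp
  have hconst : ∀ z ∈ U, k z = k z₀ := fun z hz =>
    hU.is_const_of_fderiv_eq_zero (𝕜 := ℝ) hUc
      (fun w hw => (hkd w hw).differentiableWithinAt) hk0 hz hz₀
  obtain ⟨t, ht⟩ := hU.exists_is_const_of_fderiv_eq_zero (𝕜 := ℝ) (f := fun z => Y z - k z₀ • X z)
    hUc (fun w hw => ((hYd w hw).fun_sub ((hXd w hw).fun_const_smul _)).differentiableWithinAt)
    fun z hz => by
      rw [fderiv_fun_sub (hYd z hz) ((hXd z hz).fun_const_smul _), fderiv_fun_const_smul (hXd z hz),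
        hfd z hz, hconst z hz, sub_self]
      rfl
  exact ⟨k z₀, t, hk z₀ hz₀, fun z hz => by rw [← ht z hz, add_sub_cancel]⟩

/-- The opposite signs in the v-direction cancel in the ratio of the two duality factors, so the
differentials of the two duals are proportional by a single function. -/
theorem IsChristoffelDual.exists_eq_smul_add {X T Y : ℝ × ℝ → Fin 3 → ℝ} {U : Set (ℝ × ℝ)}
    (hU : IsOpen U) (hUc : IsPreconnected U) (hT : IsChristoffelDual X T U)
    (hY : IsChristoffelDual X Y U) :
    ∃ (k : ℝ) (t : Fin 3 → ℝ), k ≠ 0 ∧ ∀ z ∈ U, Y z = k • T z + t := by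
  obtain ⟨ρ, hρ⟩ := hT.dual
  obtain ⟨σ, hσ⟩ := hY.dual
  refine exists_eq_smul_add_of_partial hU hUc hT.right.immersed hY.right.immersed.1
    (k := fun z => σ z / ρ z) (fun z hz => div_ne_zero (hσ z hz).1 (hρ z hz).1)
    (fun z hz => ?_) fun z hz => ?_
  · rw [(hσ z hz).2.1, (hρ z hz).2.1, smul_smul, div_mul_cancel₀ _ (hρ z hz).1]
  · rw [(hσ z hz).2.2, (hρ z hz).2.2, smul_smul, mul_neg, div_mul_cancel₀ _ (hρ z hz).1]

/-! ### The conjugate surface -/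

theorem contDiffOn_of_hasDerivAt {g g' : ℝ → ℝ} {W : Set ℝ} (hW : IsOpen W)
    (hg : ∀ t ∈ W, HasDerivAt g (g' t) t) (hg' : ContDiffOn ℝ ∞ g' W) : ContDiffOn ℝ ∞ g W :=
  (contDiffOn_infty_iff_deriv_of_isOpen hW).2
    ⟨fun t ht => (hg t ht).differentiableAt.differentiableWithinAt,
      hg'.congr fun t ht => (hg t ht).deriv⟩

theorem contDiffOn_waveSurface {P Q : ℝ → Fin 3 → ℝ} {W : Set ℝ} (hP : ContDiffOn ℝ ∞ P W)
    (hQ : ContDiffOn ℝ ∞ Q W) {U : Set (ℝ × ℝ)} (hU : ∀ z ∈ U, z.1 + z.2 ∈ W ∧ z.1 - z.2 ∈ W) :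
    ContDiffOn ℝ ∞ (waveSurface P Q) U :=
  (hP.comp (f := fun z : ℝ × ℝ => z.1 + z.2) (ContDiff.contDiffOn (by fun_prop))
      fun z hz => (hU z hz).1).add
    (hQ.comp (f := fun z : ℝ × ℝ => z.1 - z.2) (ContDiff.contDiffOn (by fun_prop))
      fun z hz => (hU z hz).2)

theorem hasFDerivAt_waveSurface {P Q : ℝ → Fin 3 → ℝ} {z : ℝ × ℝ} {P' Q' : Fin 3 → ℝ}
    (hP : HasDerivAt P P' (z.1 + z.2)) (hQ : HasDerivAt Q Q' (z.1 - z.2)) :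
    HasFDerivAt (waveSurface P Q)
      ((ContinuousLinearMap.toSpanSingleton ℝ P').comp
          (ContinuousLinearMap.fst ℝ ℝ ℝ + ContinuousLinearMap.snd ℝ ℝ ℝ) +
        (ContinuousLinearMap.toSpanSingleton ℝ Q').comp
          (ContinuousLinearMap.fst ℝ ℝ ℝ - ContinuousLinearMap.snd ℝ ℝ ℝ)) z := by
  have h₁ := HasFDerivAt.comp (f := fun z : ℝ × ℝ => z.1 + z.2) z hP.hasFDerivAt
    ((hasFDerivAt_fst (𝕜 := ℝ) (p := z)).add hasFDerivAt_snd)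
  have h₂ := HasFDerivAt.comp (f := fun z : ℝ × ℝ => z.1 - z.2) z hQ.hasFDerivAt
    ((hasFDerivAt_fst (𝕜 := ℝ) (p := z)).sub hasFDerivAt_snd)
  exact h₁.add h₂

theorem partialU_waveSurface {P Q : ℝ → Fin 3 → ℝ} {z : ℝ × ℝ} {P' Q' : Fin 3 → ℝ}
    (hP : HasDerivAt P P' (z.1 + z.2)) (hQ : HasDerivAt Q Q' (z.1 - z.2)) :
    partialU (waveSurface P Q) z = P' + Q' := by
  rw [partialU, (hasFDerivAt_waveSurface hP hQ).fderiv]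
  simp

theorem partialV_waveSurface {P Q : ℝ → Fin 3 → ℝ} {z : ℝ × ℝ} {P' Q' : Fin 3 → ℝ}
    (hP : HasDerivAt P P' (z.1 + z.2)) (hQ : HasDerivAt Q Q' (z.1 - z.2)) :
    partialV (waveSurface P Q) z = P' - Q' := by
  rw [partialV, (hasFDerivAt_waveSurface hP hQ).fderiv]
  simp [sub_eq_add_neg]

/-- `g₁`, `g₂`, `g₃` are primitives of `2 / dn`, `-2 sn / dn`, `2 cn / dn` on `W`. -/
structure IsPrimitiveTriple (m : ℝ) (W : Set ℝ) (g₁ g₂ g₃ : ℝ → ℝ) : Prop where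
  isOpen : IsOpen W
  dn_ne_zero : ∀ t ∈ W, jacobiDn m t ≠ 0
  hasDerivAt₁ : ∀ t ∈ W, HasDerivAt g₁ (2 / jacobiDn m t) t
  hasDerivAt₂ : ∀ t ∈ W, HasDerivAt g₂ (-(2 * jacobiSn m t / jacobiDn m t)) t
  hasDerivAt₃ : ∀ t ∈ W, HasDerivAt g₃ (2 * jacobiCn m t / jacobiDn m t) t

/-- The derivatives of the null curves. -/
noncomputable def nullDirection (m ε : ℝ) (t : ℝ) : Fin 3 → ℝ :=
  ![1 / jacobiDn m t, ε * (jacobiSn m t / jacobiDn m t), jacobiCn m t / jacobiDn m t]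

theorem contDiffOn_nullDirection {m : ℝ} (hm : m ≠ 1) (ε : ℝ) {W : Set ℝ}
    (hW : ∀ t ∈ W, jacobiDn m t ≠ 0) : ContDiffOn ℝ ∞ (nullDirection m ε) W :=
  contDiffOn_vec3 (contDiffOn_const.div (contDiff_jacobiDn hm).contDiffOn hW)
    (contDiffOn_const.mul ((contDiff_jacobiSn hm).contDiffOn.div
      (contDiff_jacobiDn hm).contDiffOn hW))
    ((contDiff_jacobiCn hm).contDiffOn.div (contDiff_jacobiDn hm).contDiffOn hW)

namespace IsPrimitiveTriple

variable {m : ℝ} {W : Set ℝ} {g₁ g₂ g₃ : ℝ → ℝ}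

theorem hasDerivAt_left (h : IsPrimitiveTriple m W g₁ g₂ g₃) {t : ℝ} (ht : t ∈ W) :
    HasDerivAt (fun t => ![g₁ t / 2, g₂ t / 2, g₃ t / 2]) (nullDirection m (-1) t) t := by
  refine (hasDerivAt_vec3 ((h.hasDerivAt₁ t ht).div_const 2) ((h.hasDerivAt₂ t ht).div_const 2)
    ((h.hasDerivAt₃ t ht).div_const 2)).congr_deriv ?_
  ext i
  fin_cases i <;> simp [nullDirection] <;> ring

theorem hasDerivAt_right (h : IsPrimitiveTriple m W g₁ g₂ g₃) {t : ℝ} (ht : t ∈ W) :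
    HasDerivAt (fun t => ![g₁ t / 2, -(g₂ t / 2), g₃ t / 2]) (nullDirection m 1 t) t := by
  refine (hasDerivAt_vec3 ((h.hasDerivAt₁ t ht).div_const 2)
    ((h.hasDerivAt₂ t ht).div_const 2).fun_neg
    ((h.hasDerivAt₃ t ht).div_const 2)).congr_deriv ?_
  ext i
  fin_cases i <;> simp [nullDirection] <;> ring

theorem contDiffOn (h : IsPrimitiveTriple m W g₁ g₂ g₃) (hm : m ≠ 1) {U : Set (ℝ × ℝ)}
    (hU : ∀ z ∈ U, z.1 + z.2 ∈ W ∧ z.1 - z.2 ∈ W) :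
    ContDiffOn ℝ ∞ (conjugateSurface g₁ g₂ g₃) U := by
  have hd := (contDiff_jacobiDn hm).contDiffOn (s := W)
  have k₁ := contDiffOn_of_hasDerivAt h.isOpen h.hasDerivAt₁
    (contDiffOn_const.div hd h.dn_ne_zero)
  have k₂ := contDiffOn_of_hasDerivAt h.isOpen h.hasDerivAt₂
    ((contDiffOn_const.mul (contDiff_jacobiSn hm).contDiffOn).div hd h.dn_ne_zero).neg
  have k₃ := contDiffOn_of_hasDerivAt h.isOpen h.hasDerivAt₃
    ((contDiffOn_const.mul (contDiff_jacobiCn hm).contDiffOn).div hd h.dn_ne_zero)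
  exact contDiffOn_waveSurface
    (contDiffOn_vec3 (k₁.div_const 2) (k₂.div_const 2) (k₃.div_const 2))
    (contDiffOn_vec3 (k₁.div_const 2) (k₂.div_const 2).neg (k₃.div_const 2)) hU

theorem partialU_eq (h : IsPrimitiveTriple m W g₁ g₂ g₃) {z : ℝ × ℝ}
    (hz : z.1 + z.2 ∈ W ∧ z.1 - z.2 ∈ W) : partialU (conjugateSurface g₁ g₂ g₃) z =
      waveSurface (nullDirection m (-1)) (nullDirection m 1) z :=
  partialU_waveSurface (h.hasDerivAt_left hz.1) (h.hasDerivAt_right hz.2)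

theorem partialV_eq (h : IsPrimitiveTriple m W g₁ g₂ g₃) {z : ℝ × ℝ}
    (hz : z.1 + z.2 ∈ W ∧ z.1 - z.2 ∈ W) : partialV (conjugateSurface g₁ g₂ g₃) z =
      waveSurface (nullDirection m (-1)) (fun t => -nullDirection m 1 t) z :=
  (partialV_waveSurface (h.hasDerivAt_left hz.1) (h.hasDerivAt_right hz.2)).trans
    (sub_eq_add_neg _ _)

end IsPrimitiveTriple

/-- The formulas at u-v are those at u+v with v replaced by -v, over the same D. The sum and the
difference therefore keep only the parts even or odd in v, each a single monomial. -/
theorem nullDirection_add_sub {m : ℝ} (hm : m ≠ 1) {z : ℝ × ℝ} (hz : z ∈ regularSet m) :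
    (waveSurface (nullDirection m (-1)) (nullDirection m 1) z = (2 / jacobiDnProd m z.1 z.2) •
      ![jacobiDn m z.1 * jacobiDn m z.2, -(jacobiSn m z.2 * jacobiDn m z.2 * jacobiCn m z.1),
        jacobiCn m z.1 * jacobiDn m z.1 * (jacobiCn m z.2 * jacobiDn m z.2)]) ∧
    waveSurface (nullDirection m (-1)) (fun t => -nullDirection m 1 t) z =
      (2 / jacobiDnProd m z.1 z.2) •
      ![m * jacobiSn m z.1 * jacobiSn m z.2 * jacobiCn m z.1 * jacobiCn m z.2,
        -(jacobiSn m z.1 * jacobiDn m z.1 * jacobiCn m z.2),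
        -((1 - m) * jacobiSn m z.1 * jacobiSn m z.2)] := by
  obtain ⟨u, v⟩ := z
  obtain ⟨-, -, h3, h4⟩ := hz
  dsimp only at h3 h4 ⊢
  have hD := jacobiDnProd_ne_zero hm h3 h4
  have hD' : jacobiDnProd m u (-v) ≠ 0 := by rwa [jacobiDnProd_neg hm]
  have a₁ := one_div_jacobiDn_add hm h3 hD
  have a₂ := jacobiSn_div_jacobiDn_add hm h3 hD
  have a₃ := jacobiCn_div_jacobiDn_add hm h3 hD
  rw [sub_eq_add_neg] at h4
  have b₁ := one_div_jacobiDn_add hm h4 hD'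
  have b₂ := jacobiSn_div_jacobiDn_add hm h4 hD'
  have b₃ := jacobiCn_div_jacobiDn_add hm h4 hD'
  simp only [jacobiDnProd_neg hm, jacobiSn_neg hm, jacobiCn_neg hm, jacobiDn_neg hm,
    ← sub_eq_add_neg u v] at b₁ b₂ b₃
  constructor <;> ext i <;> fin_cases i <;>
    simp only [waveSurface, nullDirection, Pi.add_apply, Pi.neg_apply, Pi.smul_apply, smul_eq_mul,
      Fin.zero_eta, Fin.mk_one, Fin.reduceFinMk, Matrix.cons_val, a₁, a₂, a₃, b₁, b₂, b₃] <;> ring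

namespace IsPrimitiveTriple

variable {m : ℝ} {W : Set ℝ} {g₁ g₂ g₃ : ℝ → ℝ}

theorem isTimelikeMinimal (h : IsPrimitiveTriple m W g₁ g₂ g₃) (hm : m ≠ 1) {U : Set (ℝ × ℝ)}
    (hUo : IsOpen U) (hUr : U ⊆ regularSet m) (hU : ∀ z ∈ U, z.1 + z.2 ∈ W ∧ z.1 - z.2 ∈ W) :
    IsTimelikeMinimal (conjugateSurface g₁ g₂ g₃) U := by
  have hE : ∀ z ∈ U, formE (conjugateSurface g₁ g₂ g₃) z =
      -(4 * jacobiSn m z.1 ^ 2 * jacobiDn m z.2 ^ 2 / jacobiDnProd m z.1 z.2) ∧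
      formG (conjugateSurface g₁ g₂ g₃) z =
      4 * jacobiSn m z.1 ^ 2 * jacobiDn m z.2 ^ 2 / jacobiDnProd m z.1 z.2 ∧
      formF (conjugateSurface g₁ g₂ g₃) z = 0 := fun z hz => by
    obtain ⟨eu, ev⟩ := nullDirection_add_sub hm (hUr hz)
    rw [formE, formG, formF, h.partialU_eq (hU z hz), h.partialV_eq (hU z hz), eu, ev]
    obtain ⟨-, -, h3, h4⟩ := hUr hz
    have hD := jacobiDnProd_ne_zero hm h3 h4
    have hDe := jacobiDnProd.eq_1 m z.1 z.2
    have c1 := jacobiCn_sq hm z.1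
    have c2 := jacobiCn_sq hm z.2
    have d1 := jacobiDn_sq m z.1
    have d2 := jacobiDn_sq m z.2
    simp only [mink, Pi.smul_apply, smul_eq_mul, Matrix.cons_val]
    generalize jacobiDnProd m z.1 z.2 = D, jacobiSn m z.1 = S₁, jacobiCn m z.1 = C₁,
      jacobiDn m z.1 = D₁, jacobiSn m z.2 = S₂, jacobiCn m z.2 = C₂, jacobiDn m z.2 = D₂ at *
    refine ⟨?_, ?_, ?_⟩ <;> field_simp <;> clear * - hDe c1 c2 d1 d2 <;> grind
  have hneg : ∀ z ∈ U, formE (conjugateSurface g₁ g₂ g₃) z * formG (conjugateSurface g₁ g₂ g₃) z -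
      formF (conjugateSurface g₁ g₂ g₃) z ^ 2 < 0 := fun z hz => by
    obtain ⟨e1, e2, e3⟩ := hE z hz
    obtain ⟨h1, h2, h3, h4⟩ := hUr hz
    have hD := jacobiDnProd_ne_zero hm h3 h4
    have : 4 * jacobiSn m z.1 ^ 2 * jacobiDn m z.2 ^ 2 / jacobiDnProd m z.1 z.2 ≠ 0 := by positivity
    rw [e1, e2, e3]
    have := pow_pos (abs_pos.2 this) 2
    rw [sq_abs] at this
    linarith
  refine ⟨⟨h.contDiffOn hm hU, fun z hz => ?_⟩, hneg, fun z hz => ?_⟩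
  · obtain ⟨e1, e2, e3⟩ := hE z hz
    have hn := hneg z hz
    rw [e3] at hn
    rw [LinearIndependent.pair_iff]
    intro s t hst
    -- Pairing a linear relation with S_u and S_v isolates each coefficient, since F = 0 and E, G ≠
    -- 0.
    have m1 : s * formE (conjugateSurface g₁ g₂ g₃) z + t * formF (conjugateSurface g₁ g₂ g₃) z =
        mink (partialU (conjugateSurface g₁ g₂ g₃) z) (s • partialU (conjugateSurface g₁ g₂ g₃) z +
          t • partialV (conjugateSurface g₁ g₂ g₃) z) := by
      simp only [formE, formF, mink, Pi.add_apply, Pi.smul_apply, smul_eq_mul]; ring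
    have m2 : s * formF (conjugateSurface g₁ g₂ g₃) z + t * formG (conjugateSurface g₁ g₂ g₃) z =
        mink (partialV (conjugateSurface g₁ g₂ g₃) z) (s • partialU (conjugateSurface g₁ g₂ g₃) z +
          t • partialV (conjugateSurface g₁ g₂ g₃) z) := by
      simp only [formF, formG, mink, Pi.add_apply, Pi.smul_apply, smul_eq_mul]; ring
    rw [hst, e3] at m1 m2
    simp only [mink, Pi.zero_apply, mul_zero, neg_zero, add_zero, zero_add] at m1 m2
    constructor
    · refine (mul_eq_zero.1 m1).resolve_right fun h0 => ?_
      rw [h0] at hn; simp at hn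
    · refine (mul_eq_zero.1 m2).resolve_right fun h0 => ?_
      rw [h0] at hn; simp at hn
  · obtain ⟨e1, e2, e3⟩ := hE z hz
    have hnd : ∀ ε, ∀ t ∈ W, HasDerivAt (nullDirection m ε) (deriv (nullDirection m ε) t) t :=
      fun ε t ht => (((contDiffOn_nullDirection hm ε h.dn_ne_zero).contDiffAt
        (h.isOpen.mem_nhds ht)).differentiableAt (by simp)).hasDerivAt
    have huu := (partialU_congr hUo (fun w hw => h.partialU_eq (hU w hw)) hz).trans
      (partialU_waveSurface (hnd (-1) _ (hU z hz).1) (hnd 1 _ (hU z hz).2))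
    have hvv := (partialV_congr hUo (fun w hw => h.partialV_eq (hU w hw)) hz).trans
      (partialV_waveSurface (hnd (-1) _ (hU z hz).1) (hnd 1 _ (hU z hz).2).fun_neg)
    -- Both second derivatives are the sum of the derivatives of the null directions, so S_uu =
    -- S_vv. With E = -G and F = 0 the numerator cancels for any normal vector.
    rw [meanCurvature, huu, hvv, e1, e2, e3, sub_neg_eq_add]
    simp

end IsPrimitiveTriple

/-! ### Duality between the hyperboloid and the scaled conjugate surface -/

/-- `axisScaling` as a continuous linear map. -/
noncomputable def axisScalingCLM (a b c : ℝ) : (Fin 3 → ℝ) →L[ℝ] (Fin 3 → ℝ) :=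
  LinearMap.toContinuousLinearMap
    { toFun := axisScaling a b c
      map_add' := fun x y => by ext i; fin_cases i <;> simp [axisScaling, mul_add]
      map_smul' := fun k x => by ext i; fin_cases i <;> simp [axisScaling] <;> ring }

theorem fderiv_axisScaling (a b c : ℝ) {S : ℝ × ℝ → Fin 3 → ℝ} {z : ℝ × ℝ}
    (hS : DifferentiableAt ℝ S z) (h : ℝ × ℝ) :
    fderiv ℝ (fun w => axisScaling a b c (S w)) z h = axisScaling a b c (fderiv ℝ S z h) := by
  have := ((axisScalingCLM a b c).hasFDerivAt.comp z hS.hasFDerivAt).fderiv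
  exact DFunLike.congr_fun this h

theorem IsPrimitiveTriple.isChristoffelDual {m : ℝ} {W : Set ℝ} {g₁ g₂ g₃ : ℝ → ℝ}
    (h : IsPrimitiveTriple m W g₁ g₂ g₃) {a b c : ℝ} (ha : a ≠ 0) (hb : b ≠ 0)
    (hc : c ≠ 0) (hm : m ≠ 1) (habc : m * (a ^ 2 - c ^ 2) = b ^ 2 - c ^ 2) {U : Set (ℝ × ℝ)}
    (hUo : IsOpen U) (hUr : U ⊆ regularSet m) (hU : ∀ z ∈ U, z.1 + z.2 ∈ W ∧ z.1 - z.2 ∈ W) :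
    IsChristoffelDual (hyperboloid a b c m)
      (fun z => axisScaling a b c (conjugateSurface g₁ g₂ g₃ z)) U := by
  have hD : ∀ z ∈ U, jacobiDnProd m z.1 z.2 ≠ 0 := fun z hz =>
    jacobiDnProd_ne_zero hm (hUr hz).2.2.1 (hUr hz).2.2.2
  have hSd : ∀ z ∈ U, DifferentiableAt ℝ (conjugateSurface g₁ g₂ g₃) z := fun z hz =>
    ((h.contDiffOn hm hU).contDiffAt (hUo.mem_nhds hz)).differentiableAt (by simp)
  refine isChristoffelDual_of_partial hUo
    (isCurvatureLineParametrization_hyperboloid ha hb hc hm habc hUo hUr)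
    ((axisScalingCLM a b c).contDiff.comp_contDiffOn (h.contDiffOn hm hU))
    -- Read off from the scalar prefactors in `hyperboloidU` and `nullDirection_add_sub`; it has no
    -- zeros since sn u, dn v ≠ 0.
    (ρ := fun z => -(2 * jacobiSn m z.1 ^ 2 * jacobiDn m z.2 ^ 2) * (jacobiDnProd m z.1 z.2)⁻¹)
    (fun z hz => ?_) (fun z hz => ?_) (fun z hz => ?_) fun z hz => ?_
  · have hs := (contDiff_jacobiSn hm).differentiable (by simp)
    have hc := (contDiff_jacobiCn hm).differentiable (by simp)
    have hd := (contDiff_jacobiDn hm).differentiable (by simp)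
    have hDd : DifferentiableAt ℝ (fun z : ℝ × ℝ => jacobiDnProd m z.1 z.2) z := by
      unfold jacobiDnProd; fun_prop
    exact DifferentiableAt.fun_mul (by fun_prop) (hDd.fun_inv (hD z hz))
  · obtain ⟨h1, h2, -⟩ := hUr hz
    exact mul_ne_zero (neg_ne_zero.2 (by positivity)) (inv_ne_zero (hD z hz))
  · rw [partialU_hyperboloid a b c hm hUo hUr hz, partialU, fderiv_axisScaling a b c (hSd z hz),
      ← partialU, h.partialU_eq (hU z hz), (nullDirection_add_sub hm (hUr hz)).1]
    obtain ⟨h1, h2, -⟩ := hUr hz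
    have := hD z hz
    ext i
    fin_cases i <;> simp [hyperboloidU, axisScaling, -mul_eq_mul_left_iff, -mul_eq_mul_right_iff] <;>
      field_simp
  · rw [partialV_hyperboloid a b c hm hUo hUr hz, partialV, fderiv_axisScaling a b c (hSd z hz),
      ← partialV, h.partialV_eq (hU z hz), (nullDirection_add_sub hm (hUr hz)).2]
    obtain ⟨h1, h2, -⟩ := hUr hz
    have := hD z hz
    ext i
    fin_cases i <;> simp [hyperboloidV, axisScaling, -mul_eq_mul_left_iff, -mul_eq_mul_right_iff] <;>
      field_simp

/-! ### Local comparison of primitives and the main theorem -/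

theorem exists_eventually_eq_add {f g f' : ℝ → ℝ} {x : ℝ}
    (hf : ∀ᶠ t in nhds x, HasDerivAt f (f' t) t) (hg : ∀ᶠ t in nhds x, HasDerivAt g (f' t) t) :
    ∃ k, ∀ᶠ t in nhds x, f t = g t + k := by
  obtain ⟨ε, hε, h⟩ := Metric.eventually_nhds_iff_ball.1 (hf.and hg)
  refine ⟨f x - g x, Metric.eventually_nhds_iff_ball.2 ⟨ε, hε, fun t ht => ?_⟩⟩
  have := Metric.isOpen_ball.is_const_of_deriv_eq_zero (f := fun t => f t - g t)
    (convex_ball x ε).isPreconnected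
    (fun s hs => ((h s hs).1.fun_sub (h s hs).2).differentiableAt.differentiableWithinAt)
    (fun s hs => by rw [((h s hs).1.fun_sub (h s hs).2).deriv, sub_self]; rfl)
    ht (Metric.mem_ball_self hε)
  linarith

theorem mainTheorem5 (a b c : ℝ) (ha : 0 < a) (hb : 0 < b) (hc : 0 < c)
    (hab : a ≠ b) (hbc : b ≠ c) (hac : a ≠ c)
    (m : ℝ) (hm : m = (b ^ 2 - c ^ 2) / (a ^ 2 - c ^ 2))
    (p q : ℂ) (hp : p ^ 2 = (((a ^ 2 - b ^ 2) / (a ^ 2 - c ^ 2) : ℝ) : ℂ))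
    (hq : q ^ 2 = (m : ℂ))
    (U : Set (ℝ × ℝ)) (hUo : IsOpen U) (hUc : IsPreconnected U) (hUr : U ⊆ regularSet m) :
    (∀ z ∈ U, -(hyperboloid a b c m z 0 / a) ^ 2 + (hyperboloid a b c m z 1 / b) ^ 2
      + (hyperboloid a b c m z 2 / c) ^ 2 = 1) ∧
    IsCurvatureLineParametrization (hyperboloid a b c m) U ∧
    ∃ S : ℝ × ℝ → Fin 3 → ℝ,
      IsTimelikeMinimal S U ∧
      IsChristoffelDual (hyperboloid a b c m) (fun z => axisScaling a b c (S z)) U ∧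
      (∀ Y : ℝ × ℝ → Fin 3 → ℝ, IsChristoffelDual (hyperboloid a b c m) Y U →
        ∃ (k : ℝ) (t : Fin 3 → ℝ), k ≠ 0 ∧ ∀ z ∈ U, Y z = k • axisScaling a b c (S z) + t) ∧
      (U ⊆ formulaSet m →
        ∀ z ∈ U, axisScaling a b c (S z) = dualFormula a b c m p q ⟨z.1, z.2⟩) ∧
      (∀ z₀ ∈ U ∩ formulaSet m, ∃ t : Fin 3 → ℝ, ∀ᶠ z in nhds z₀,
        axisScaling a b c (S z) = dualFormula a b c m p q ⟨z.1, z.2⟩ + t) := by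
  have sq_sub_ne : ∀ {x y : ℝ}, 0 < x → 0 < y → x ≠ y → x ^ 2 - y ^ 2 ≠ 0 := fun hx hy hxy =>
    sub_ne_zero.2 fun h => hxy ((sq_eq_sq₀ hx.le hy.le).1 h)
  have hac' := sq_sub_ne ha hc hac
  have hm1' : (a ^ 2 - b ^ 2) / (a ^ 2 - c ^ 2) = 1 - m := by rw [hm]; field_simp; ring
  have habc : m * (a ^ 2 - c ^ 2) = b ^ 2 - c ^ 2 := by rw [hm, div_mul_cancel₀ _ hac']
  rw [hm1'] at hp
  have hm1 : m ≠ 1 := fun h => div_ne_zero (sq_sub_ne ha hb hab) hac' (by rw [hm1', h, sub_self])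
  have hm0 : m ≠ 0 := hm ▸ div_ne_zero (sq_sub_ne hb hc hbc) hac'
  clear hm hm1'
  have hq0 : q ≠ 0 := by
    rintro rfl
    exact hm0 (by exact_mod_cast (by simpa using hq.symm : (m : ℂ) = 0))
  refine ⟨fun z hz => hyperboloid_mem_quadric ha.ne' hb.ne' hc.ne' hm1 (hUr hz),
    isCurvatureLineParametrization_hyperboloid ha.ne' hb.ne' hc.ne' hm1 habc hUo hUr, ?_⟩
  have hd := (contDiff_jacobiDn hm1).continuous
  have hs := (contDiff_jacobiSn hm1).continuous
  have hdo : IsOpen {t | jacobiDn m t ≠ 0} := isOpen_ne_fun hd continuous_const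
  have hso : IsOpen {t | jacobiSn m t ≠ 0} := isOpen_ne_fun hs continuous_const
  have hfm : IsPrimitiveTriple m ({t | jacobiDn m t ≠ 0} ∩ {t | jacobiSn m t ≠ 0})
      (timePrimitive m p) (snPrimitive m p q) (cnPrimitive m q) :=
    ⟨hdo.inter hso, fun t ht => ht.1, fun t ht => hasDerivAt_timePrimitive hm1 hp ht.1 ht.2,
      fun t ht => hasDerivAt_snPrimitive hm1 hp hq hq0 ht.1,
      fun t ht => hasDerivAt_cnPrimitive hm1 hq hq0 ht.1⟩
  -- The choice of S depends on U: if sn(u ± v) never vanishes on U, take the explicit primitive, so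
  -- that the formula holds with no additive constant even when its domain is disconnected.
  -- Otherwise take a primitive of 2/dn on all of dn ≠ 0.
  obtain ⟨W, g, hg, hWU, hgf⟩ : ∃ (W : Set ℝ) (g : ℝ → ℝ),
      IsPrimitiveTriple m W g (snPrimitive m p q) (cnPrimitive m q) ∧
      (∀ z ∈ U, z.1 + z.2 ∈ W ∧ z.1 - z.2 ∈ W) ∧
      (U ⊆ formulaSet m → g = timePrimitive m p) := by
    by_cases hf : U ⊆ formulaSet m
    · exact ⟨_, _, hfm, fun z hz => ⟨⟨(hUr hz).2.2.1, (hf hz).1⟩, (hUr hz).2.2.2, (hf hz).2⟩,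
        fun _ => rfl⟩
    · obtain ⟨g, hg⟩ := exists_primitive_two_div_jacobiDn hm1
      exact ⟨_, g, ⟨hdo, fun t ht => ht, fun t ht => hg t ht,
        fun t ht => hasDerivAt_snPrimitive hm1 hp hq hq0 ht,
        fun t ht => hasDerivAt_cnPrimitive hm1 hq hq0 ht⟩,
        fun z hz => ⟨(hUr hz).2.2.1, (hUr hz).2.2.2⟩, fun h => absurd h hf⟩
  have hdual := hg.isChristoffelDual ha.ne' hb.ne' hc.ne' hm1 habc hUo hUr hWU
  refine ⟨conjugateSurface g (snPrimitive m p q) (cnPrimitive m q),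
    hg.isTimelikeMinimal hm1 hUo hUr hWU, hdual,
    fun Y hY => hdual.exists_eq_smul_add hUo hUc hY,
    fun hf z _ => by rw [dualFormula_eq, hgf hf], fun z₀ hz₀ => ?_⟩
  obtain ⟨hzU, hzf⟩ := hz₀
  have hloc : ∀ x ∈ W, jacobiSn m x ≠ 0 → ∃ k, ∀ᶠ t in nhds x, g t = timePrimitive m p t + k := by
    intro x hx hsx
    refine exists_eventually_eq_add (f' := fun t => 2 / jacobiDn m t) ?_ ?_
    · filter_upwards [hg.isOpen.mem_nhds hx] with t ht using hg.hasDerivAt₁ t ht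
    · filter_upwards [hfm.isOpen.mem_nhds ⟨hg.dn_ne_zero x hx, hsx⟩] with t ht
        using hfm.hasDerivAt₁ t ht
  obtain ⟨k₁, hk₁⟩ := hloc _ (hWU z₀ hzU).1 hzf.1
  obtain ⟨k₂, hk₂⟩ := hloc _ (hWU z₀ hzU).2 hzf.2
  -- Only the first primitive can differ from the explicit one. Its local constants k₁ at u+v and k₂
  -- at u-v each enter with weight 1/2.
  refine ⟨![a * ((k₁ + k₂) / 2), 0, 0], ?_⟩
  have t₁ : Filter.Tendsto (fun z : ℝ × ℝ => z.1 + z.2) (nhds z₀) (nhds (z₀.1 + z₀.2)) :=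
    Continuous.tendsto (by fun_prop) z₀
  have t₂ : Filter.Tendsto (fun z : ℝ × ℝ => z.1 - z.2) (nhds z₀) (nhds (z₀.1 - z₀.2)) :=
    Continuous.tendsto (by fun_prop) z₀
  filter_upwards [t₁.eventually hk₁, t₂.eventually hk₂] with z h₁ h₂
  rw [dualFormula_eq]
  ext i
  fin_cases i
  · simp only [axisScaling, conjugateSurface, waveSurface, Pi.add_apply, Fin.zero_eta,
      Matrix.cons_val, h₁, h₂]
    ring
  · simp [axisScaling, conjugateSurface, waveSurface]
  · simp [axisScaling, conjugateSurface, waveSurface]
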